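/- Let $q_0,q_1,q_2$ be the vertices of an equilateral triangle in the plane (indices mod 3), $F_i(x)=\tfrac12(x-q_i)+q_i$, and let $SG$ be the Sierpinski gasket, the nonempty compact set with $SG=\bigcup_i F_i(SG)$. Let $\mu$ be the probability measure on $SG$ that gives mass $3^{-m}$ to each cell $F_{w_1}\circ\dots\circ F_{w_m}(SG)$, and write $\langle u,v\rangle=\int_{SG}uv\,d\mu$. Let $\Gamma_m$ be the graph with vertex set $V_m=\bigcup_{|w|=m}F_w(\{q_0,q_1,q_2\})$ whose edges $x\sim_m y$ join the distinct corners of each cell of level $m$. For continuous $u,f$ on $SG$, $\Delta u=f$ means that $\tfrac32 5^m\sum_{y\sim_m x}(u(y)-u(x))\to f(x)$ as $m\to\infty$, uniformly for $x\in V_m\setminus V_0$. Set $$\partial_n u(q_i)=\lim_{m\to\infty}(5/3)^m\big(2u(q_i)-u(F_i^mq_{i+1})-u(F_i^mq_{i-1})\big),\qquad \partial_T u(q_i)=\lim_{m\to\infty}5^m\big(u(F_i^mq_{i+1})-u(F_i^mq_{i-1})\big).$$ For $n\in\{0,1,2\}$, $i\in\{1,2,3\}$, $j\ge 0$ let $P^{(n)}_{ji}$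 be the monomial at $q_n$: the solution of $\Delta^{j+1}P^{(n)}_{ji}=0$ with $$\Delta^mP^{(n)}_{ji}(q_n)=\delta_{mj}\delta_{i1},\quad \partial_n\Delta^mP^{(n)}_{ji}(q_n)=\delta_{mj}\delta_{i2},\quad \partial_T\Delta^mP^{(n)}_{ji}(q_n)=\delta_{mj}\delta_{i3}\qquad(0\le m\le j).$$ Write $P_{ji}=P^{(0)}_{ji}$, $\alpha_j=P_{j1}(q_1)$, $\beta_j=P_{j2}(q_1)$, $\eta_j=\partial_nP_{j1}(q_1)$ (this normal derivative exists), and let $\alpha'_0=\tfrac12$ and $\alpha'_j=\alpha_j$ for $j\ge1$. Then for all $j,k\ge0$, with $m_*=\min(j,k)$, $$\langle P_{j1},P_{k1}\rangle=2\sum_{\ell=j-m_*}^{j}\big(\alpha_{j-\ell}\eta_{k+\ell+1}-\alpha_{k+\ell+1}\eta_{j-\ell}\big),$$ $$\langle P_{j2},P_{k2}\rangle=-2\sum_{\ell=j-m_*}^{j}\big(\beta_{j-\ell}\alpha'_{k+\ell+1}-\beta_{k+\ell+1}\alpha'_{j-\ell}\big),$$ $$\langle P_{j3},P_{k3}\rangle=18\sum_{\ell=j-m_*}^{j}\big(\alpha_{j-\ell+1}\eta_{k+\ell+2}-\alpha_{k+\ell+2}\eta_{j-\ell+1}\big),$$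 $$\langle P_{j1},P_{k2}\rangle=-2\sum_{\ell=0}^{j}\big(\alpha_{j-\ell}\alpha_{k+\ell+1}+\beta_{k+\ell+1}\eta_{j-\ell}\big),$$ $$\langle P_{j1},P_{k3}\rangle=\langle P_{j2},P_{k3}\rangle=0,$$ and for all $n,n'\in\{0,1,2\}$ $$\langle P^{(n)}_{j3},P^{(n)}_{k3}\rangle=\langle P_{j3},P_{k3}\rangle,\qquad \langle P^{(n)}_{j3},P^{(n')}_{k3}\rangle=-\tfrac12\langle P_{j3},P_{k3}\rangle\quad\text{if }n\ne n'.$$ -/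

import Mathlib

open Filter Topology MeasureTheory

noncomputable section

namespace SierpinskiGasket

/-- The Euclidean plane. -/
abbrev Plane : Type := EuclideanSpace ℝ (Fin 2)

/-- `q 0`, `q 1`, `q 2` are the vertices of a (non-degenerate) equilateral triangle. -/
def IsEquilateral (q : Fin 3 → Plane) : Prop :=
  ∃ d : ℝ, 0 < d ∧ ∀ i j, i ≠ j → dist (q i) (q j) = d

/-- The contraction `x ↦ (x - qᵢ) / 2 + qᵢ` of the plane. -/
def contraction (q : Fin 3 → Plane) (i : Fin 3) (x : Plane) : Plane :=
  (1 / 2 : ℝ) • (x - q i) + q i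

/-- The point `lim_m F_{a₀} ∘ ⋯ ∘ F_{aₘ} (x)` of the plane with address `a₀ a₁ a₂ …`. -/
def address (q : Fin 3 → Plane) (a : ℕ → Fin 3) : Plane :=
  ∑' k : ℕ, (1 / 2 : ℝ) ^ (k + 1) • q (a k)

/-- The Sierpinski gasket: the set of all points that have an address. It is the attractor of the
three contractions, that is, the nonempty compact set that is the union of its images under them:
see `gasket_nonempty`, `isCompact_gasket` and `gasket_eq_iUnion`. -/
def gasket (q : Fin 3 → Plane) : Set Plane := Set.range (address q)

/-- The sequence `i, a₀, a₁, …`. -/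
def cons (i : Fin 3) (a : ℕ → Fin 3) : ℕ → Fin 3
  | 0 => i
  | k + 1 => a k

theorem cons_head_tail (a : ℕ → Fin 3) : cons (a 0) (fun k => a (k + 1)) = a := by
  funext k
  cases k <;> rfl

theorem exists_norm_le (q : Fin 3 → Plane) : ∀ i, ‖q i‖ ≤ ∑ j, ‖q j‖ := fun i =>
  Finset.single_le_sum (f := fun j => ‖q j‖) (fun j _ => norm_nonneg (q j)) (Finset.mem_univ i)

theorem norm_term_le (q : Fin 3 → Plane) (a : ℕ → Fin 3) (k : ℕ) :
    ‖(1 / 2 : ℝ) ^ (k + 1) • q (a k)‖ ≤ (1 / 2 : ℝ) ^ k * ∑ j, ‖q j‖ := by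
  rw [norm_smul, norm_pow, Real.norm_of_nonneg (by norm_num : (0 : ℝ) ≤ 1 / 2)]
  apply mul_le_mul _ (exists_norm_le q _) (norm_nonneg _) (by positivity)
  exact pow_le_pow_of_le_one (by norm_num) (by norm_num) (Nat.le_succ k)

theorem summable_bound (q : Fin 3 → Plane) :
    Summable fun k : ℕ => (1 / 2 : ℝ) ^ k * ∑ j, ‖q j‖ :=
  (summable_geometric_of_lt_one (by norm_num) (by norm_num)).mul_right _

theorem summable_term (q : Fin 3 → Plane) (a : ℕ → Fin 3) :
    Summable fun k : ℕ => (1 / 2 : ℝ) ^ (k + 1) • q (a k) :=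
  Summable.of_norm_bounded (summable_bound q) (norm_term_le q a)

theorem continuous_address (q : Fin 3 → Plane) : Continuous (address q) := by
  refine continuous_tsum (fun k => ?_) (summable_bound q) (fun k a => norm_term_le q a k)
  have h : Continuous fun a : ℕ → Fin 3 => q (a k) :=
    (continuous_of_discreteTopology (f := q)).comp (continuous_apply (A := fun _ => Fin 3) k)
  exact h.const_smul ((1 / 2 : ℝ) ^ (k + 1))

theorem address_cons (q : Fin 3 → Plane) (i : Fin 3) (a : ℕ → Fin 3) :
    address q (cons i a) = contraction q i (address q a) := by
  have h : address q (cons i a) = (1 / 2 : ℝ) ^ (0 + 1) • q i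
      + ∑' k : ℕ, (1 / 2 : ℝ) ^ (k + 1 + 1) • q (a k) :=
    (summable_term q (cons i a)).tsum_eq_zero_add
  rw [h, contraction, address, smul_sub, ← tsum_const_smul'' (1 / 2 : ℝ)]
  have : ∀ k : ℕ, (1 / 2 : ℝ) ^ (k + 1 + 1) • q (a k)
      = (1 / 2 : ℝ) • (1 / 2 : ℝ) ^ (k + 1) • q (a k) := fun k => by
    rw [smul_smul, ← pow_succ']
  simp only [this, zero_add, pow_one]
  module

theorem gasket_nonempty (q : Fin 3 → Plane) : (gasket q).Nonempty := Set.range_nonempty _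

theorem isCompact_gasket (q : Fin 3 → Plane) : IsCompact (gasket q) :=
  isCompact_range (continuous_address q)

theorem contraction_mem (q : Fin 3 → Plane) (i : Fin 3) {x : Plane} (hx : x ∈ gasket q) :
    contraction q i x ∈ gasket q := by
  obtain ⟨a, rfl⟩ := hx
  exact ⟨cons i a, address_cons q i a⟩

theorem gasket_eq_iUnion (q : Fin 3 → Plane) : gasket q = ⋃ i, contraction q i '' gasket q := by
  ext x
  simp only [Set.mem_iUnion]
  constructor
  · rintro ⟨a, rfl⟩
    refine ⟨a 0, address q (fun k => a (k + 1)), ⟨_, rfl⟩, ?_⟩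
    rw [← address_cons, cons_head_tail]
  · rintro ⟨i, y, hy, rfl⟩
    exact contraction_mem q i hy

theorem hasSum_half : HasSum (fun k : ℕ => (1 / 2 : ℝ) ^ (k + 1)) 1 := by
  have := (hasSum_geometric_of_lt_one (r := (1 / 2 : ℝ)) (by norm_num) (by norm_num)).mul_left
    (1 / 2 : ℝ)
  simp only [← pow_succ'] at this
  norm_num at this ⊢
  exact this

theorem vertex_mem (q : Fin 3 → Plane) (i : Fin 3) : q i ∈ gasket q := by
  refine ⟨fun _ => i, ?_⟩
  have h := (hasSum_half.smul_const (q i)).tsum_eq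
  rw [one_smul] at h
  exact h

instance (q : Fin 3 → Plane) : CompactSpace (gasket q) :=
  isCompact_iff_compactSpace.mp (isCompact_gasket q)

/-- The boundary point `qᵢ` as a point of the gasket. -/
def vertex (q : Fin 3 → Plane) (i : Fin 3) : gasket q := ⟨q i, vertex_mem q i⟩

/-- The contraction `Fᵢ` as a map of the gasket to itself. -/
def F (q : Fin 3 → Plane) (i : Fin 3) (x : gasket q) : gasket q :=
  ⟨contraction q i x, contraction_mem q i x.2⟩

/-- `F_w = F_{w₁} ∘ ⋯ ∘ F_{wₘ}` for a word `w = [w₁, …, wₘ]`. -/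
def wordMap (q : Fin 3 → Plane) : List (Fin 3) → gasket q → gasket q
  | [] => id
  | i :: w => F q i ∘ wordMap q w

/-- The cell `F_w (SG)`, of level `|w|`. -/
def cell (q : Fin 3 → Plane) (w : List (Fin 3)) : Set (gasket q) := Set.range (wordMap q w)

/-- The vertex set `V_m` of the graph `Γ_m`. -/
def V (q : Fin 3 → Plane) (m : ℕ) : Set (gasket q) :=
  {x | ∃ w : List (Fin 3), w.length = m ∧ ∃ i, x = wordMap q w (vertex q i)}

/-- The edge relation of `Γ_m`: `x` and `y` are distinct corners of one cell of level `m`. -/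
def Adj (q : Fin 3 → Plane) (m : ℕ) (x y : gasket q) : Prop :=
  ∃ w : List (Fin 3), w.length = m ∧ ∃ i j, i ≠ j ∧
    x = wordMap q w (vertex q i) ∧ y = wordMap q w (vertex q j)

/-- The graph Laplacian `Δ_m u (x) = ∑_{y ∼ₘ x} (u y - u x)`; the sum is over a finite set. -/
def graphLaplacian (q : Fin 3 → Plane) (m : ℕ) (u : gasket q → ℝ) (x : gasket q) : ℝ :=
  ∑ᶠ y ∈ {y | Adj q m x y}, (u y - u x)

/-- `u` is in the domain of the Laplacian and `Δ u = f`: `u` and `f` are continuous and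
`(3/2) 5^m Δ_m u → f` uniformly on the set `V_* \ V₀` of junction points. -/
def HasLaplacian (q : Fin 3 → Plane) (u f : C(gasket q, ℝ)) : Prop :=
  ∀ ε : ℝ, 0 < ε → ∃ M : ℕ, ∀ m, M ≤ m → ∀ x ∈ V q m \ V q 0,
    |3 / 2 * 5 ^ m * graphLaplacian q m u x - f x| < ε

/-- The normal derivative `∂ₙ u (qᵢ)` exists and equals `d` (indices are mod 3). -/
def HasNormalDeriv (q : Fin 3 → Plane) (u : gasket q → ℝ) (i : Fin 3) (d : ℝ) : Prop :=
  Tendsto (fun m : ℕ => (5 / 3 : ℝ) ^ m * (2 * u (vertex q i)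
    - u ((F q i)^[m] (vertex q (i + 1))) - u ((F q i)^[m] (vertex q (i - 1))))) atTop (𝓝 d)

/-- The tangential derivative `∂_T u (qᵢ)` exists and equals `d` (indices are mod 3). -/
def HasTangentialDeriv (q : Fin 3 → Plane) (u : gasket q → ℝ) (i : Fin 3) (d : ℝ) : Prop :=
  Tendsto (fun m : ℕ => (5 : ℝ) ^ m * (u ((F q i)^[m] (vertex q (i + 1)))
    - u ((F q i)^[m] (vertex q (i - 1))))) atTop (𝓝 d)

/-- `P` is the monomial `P_{ji}^{(n)}`, for `i = 1, 2, 3`: `Δ^{j+1} P = 0`, and at the boundary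
point `qₙ` the values, normal derivatives and tangential derivatives of `Δ^m P`, `0 ≤ m ≤ j`, are
`δ_{mj} δ_{i1}`, `δ_{mj} δ_{i2}` and `δ_{mj} δ_{i3}`. Here `u m` is `Δ^m P`. -/
def IsMonomial (q : Fin 3 → Plane) (n : Fin 3) (j i : ℕ) (P : C(gasket q, ℝ)) : Prop :=
  ∃ u : ℕ → C(gasket q, ℝ), u 0 = P ∧ (∀ m ≤ j, HasLaplacian q (u m) (u (m + 1))) ∧
    u (j + 1) = 0 ∧ ∀ m ≤ j,
      u m (vertex q n) = (if m = j ∧ i = 1 then 1 else 0) ∧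
      HasNormalDeriv q (u m) n (if m = j ∧ i = 2 then 1 else 0) ∧
      HasTangentialDeriv q (u m) n (if m = j ∧ i = 3 then 1 else 0)

/-- The uniform probability measure on the set of addresses: the digits are independent and each
takes the values `0, 1, 2` with probability `1/3`. -/
def addressMeasure : Measure (ℕ → Fin 3) :=
  Measure.infinitePi fun _ => (PMF.uniformOfFintype (Fin 3)).toMeasure

/-- The point of the gasket with address `a`. -/
def point (q : Fin 3 → Plane) (a : ℕ → Fin 3) : gasket q := ⟨address q a, a, rfl⟩

/-- The natural probability measure on the gasket, the image of the uniform measure on addresses.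
It gives mass `3^{-m}` to each cell of level `m`: see `gasketMeasure_cell`. -/
def gasketMeasure (q : Fin 3 → Plane) : Measure (gasket q) :=
  addressMeasure.map (point q)

/-- The inner product of `L²` of the gasket. -/
def ip (q : Fin 3 → Plane) (u v : C(gasket q, ℝ)) : ℝ := ∫ x, u x * v x ∂gasketMeasure q

instance : IsProbabilityMeasure addressMeasure := by
  unfold addressMeasure
  infer_instance

theorem continuous_point (q : Fin 3 → Plane) :
    Continuous (point q) :=
  Continuous.subtype_mk (continuous_address q) _

instance (q : Fin 3 → Plane) : IsProbabilityMeasure (gasketMeasure q) :=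
  Measure.isProbabilityMeasure_map (continuous_point q).measurable.aemeasurable

/-- The sequences that start with the word `w`. -/
def cylinder (w : List (Fin 3)) : Set (ℕ → Fin 3) := {a | ∀ k (h : k < w.length), a k = w[k]}

theorem addressMeasure_cylinder (w : List (Fin 3)) :
    addressMeasure (cylinder w) = (3 : ENNReal)⁻¹ ^ w.length := by
  have h : cylinder w = Set.pi (Finset.range w.length) (fun k => {w.getD k 0}) := by
    ext a
    simp only [cylinder, Set.mem_ofPred_eq, Set.mem_pi, Finset.coe_range, Set.mem_Iio,
      Set.mem_singleton_iff]
    refine forall_congr' fun k => forall_congr' fun hk => ?_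
    rw [List.getD_eq_getElem _ _ hk]
  rw [h, addressMeasure, Measure.infinitePi_pi _ (fun _ _ => MeasurableSet.of_discrete)]
  simp

instance : NullSingletonClass addressMeasure := by
  refine ⟨fun a => ?_⟩
  have hle : ∀ n : ℕ, addressMeasure {a} ≤ (3 : ENNReal)⁻¹ ^ n := fun n => by
    have := addressMeasure_cylinder (List.ofFn fun k : Fin n => a k)
    rw [List.length_ofFn] at this
    rw [← this]
    refine measure_mono ?_
    rintro b rfl k hk
    simp
  have ht : Tendsto (fun n : ℕ => (3 : ENNReal)⁻¹ ^ n) atTop (𝓝 0) :=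
    ENNReal.tendsto_pow_atTop_nhds_zero_of_lt_one
      (ENNReal.inv_lt_one.mpr (by norm_num))
  exact le_antisymm (ge_of_tendsto' ht hle) zero_le

/-- The eventually constant sequences. -/
def evConst : Set (ℕ → Fin 3) := {a | ∃ N i, ∀ k, N ≤ k → a k = i}

theorem countable_evConst : evConst.Countable := by
  have : evConst ⊆ Set.range (fun p : List (Fin 3) × Fin 3 => fun k => p.1.getD k p.2) := by
    rintro a ⟨N, i, h⟩
    refine ⟨(List.ofFn fun k : Fin N => a k, i), ?_⟩
    funext k
    rcases lt_or_ge k N with hk | hk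
    · simp [List.getD_eq_getElem?_getD, hk]
    · simp [List.getD_eq_getElem?_getD, not_lt.mpr hk, h k hk]
  exact (Set.countable_range _).mono this

theorem exists_functional (q : Fin 3 → Plane) (hq : IsEquilateral q) (i : Fin 3) :
    ∃ (L : Plane →L[ℝ] ℝ) (c D : ℝ), 0 < D ∧ L (q i) = c + D ∧ ∀ j, j ≠ i → L (q j) = c := by
  obtain ⟨d, hd, h⟩ := hq
  have key : ∀ i j k : Fin 3, i ≠ j → i ≠ k → j ≠ k →
      inner ℝ ((q i - q j) + (q i - q k)) (q i) - inner ℝ ((q i - q j) + (q i - q k)) (q j)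
        = 3 / 2 * d ^ 2 := by
    intro i j k hij hik hjk
    have h1 := h i j hij
    have h2 := h i k hik
    have h3 := h j k hjk
    rw [dist_eq_norm] at h1 h2 h3
    have h4 : q j - q k = (q i - q k) - (q i - q j) := by abel
    rw [h4] at h3
    have h5 := norm_sub_sq_real (q i - q k) (q i - q j)
    rw [h1, h2, h3, real_inner_comm] at h5
    rw [← inner_sub_right, inner_add_left, real_inner_self_eq_norm_sq, h1,
      real_inner_comm]
    linarith
  obtain ⟨j, k, hij, hik, hjk, hall⟩ : ∃ j k : Fin 3, i ≠ j ∧ i ≠ k ∧ j ≠ k ∧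
      ∀ l, l ≠ i → l = j ∨ l = k := by
    revert i; decide
  refine ⟨innerSL ℝ ((q i - q j) + (q i - q k)),
    inner ℝ ((q i - q j) + (q i - q k)) (q j), 3 / 2 * d ^ 2, by positivity, ?_, ?_⟩
  · have := key i j k hij hik hjk
    simp only [innerSL_apply_apply]
    linarith
  · intro l hl
    have h1 := key i j k hij hik hjk
    have h2 := key i k j hik hij hjk.symm
    rw [add_comm (q i - q k)] at h2
    simp only [innerSL_apply_apply]
    rcases hall l hl with rfl | rfl
    · rfl
    · linarith

theorem eq_of_mem (q : Fin 3 → Plane) (hq : IsEquilateral q) (i : Fin 3) (a b : ℕ → Fin 3)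
    (h0 : a 0 ≠ i) (h : address q a = contraction q i (address q b)) :
    ∀ k, a (k + 1) = i := by
  obtain ⟨L, c, D, hD, hi, hj⟩ := exists_functional q hq i
  have hL : ∀ j, c ≤ L (q j) ∧ L (q j) ≤ c + D := fun j => by
    by_cases hji : j = i
    · rw [hji, hi]; constructor <;> linarith
    · rw [hj j hji]; constructor <;> linarith
  have hs : ∀ a : ℕ → Fin 3,
      HasSum (fun k : ℕ => (1 / 2 : ℝ) ^ (k + 1) * L (q (a k))) (L (address q a)) := fun a => by
    have h := L.hasSum (summable_term q a).hasSum
    simp only [map_smul, smul_eq_mul] at h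
    exact h
  have hb : c ≤ L (address q b) := by
    have h1 := hasSum_half.mul_right c
    rw [one_mul] at h1
    exact hasSum_le (fun k => mul_le_mul_of_nonneg_left (hL _).1 (by positivity)) h1 (hs b)
  set t : ℕ → Fin 3 := fun k => a (k + 1) with ht
  have ha : address q a = contraction q (a 0) (address q t) := by
    rw [← address_cons, cons_head_tail]
  have hc : ∀ j x, L (contraction q j x) = (L x + L (q j)) / 2 := fun j x => by
    simp only [contraction, map_add, map_smul, map_sub, smul_eq_mul]; ring
  have h2 : c + D ≤ L (address q t) := by
    have := congrArg L (ha.symm.trans h)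
    rw [hc, hc, hi, hj _ h0] at this
    linarith
  have h1 := hasSum_half.mul_right (c + D)
  rw [one_mul] at h1
  intro k
  by_contra hk
  have hlt : L (address q t) < c + D := by
    refine hasSum_lt (i := k) (fun k => mul_le_mul_of_nonneg_left (hL _).2 (by positivity)) ?_
      (hs t) h1
    refine mul_lt_mul_of_pos_left ?_ (by positivity)
    rw [hj _ hk]; linarith
  linarith

theorem contraction_injective (q : Fin 3 → Plane) (i : Fin 3) :
    Function.Injective (contraction q i) := by
  intro x y h
  simp only [contraction, add_left_inj] at h
  have := smul_right_injective Plane (by norm_num : (1 / 2 : ℝ) ≠ 0) h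
  simpa using this

theorem mem_cell_of_cylinder (q : Fin 3 → Plane) (w : List (Fin 3)) :
    ∀ a ∈ cylinder w, point q a ∈ cell q w := by
  induction w with
  | nil => intro a _; exact ⟨_, rfl⟩
  | cons i w ih =>
    intro a ha
    have h0 : a 0 = i := ha 0 (by simp)
    have ht : (fun k => a (k + 1)) ∈ cylinder w := fun k hk =>
      ha (k + 1) (Nat.succ_lt_succ hk)
    obtain ⟨x, hx⟩ := ih _ ht
    refine ⟨x, Subtype.ext ?_⟩
    change contraction q i (wordMap q w x) = address q a
    rw [hx, ← cons_head_tail a, h0, address_cons]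
    rfl

theorem cylinder_of_mem_cell (q : Fin 3 → Plane) (hq : IsEquilateral q) (w : List (Fin 3)) :
    ∀ a, point q a ∈ cell q w → a ∈ cylinder w ∪ evConst := by
  induction w with
  | nil => intro a _; left; intro k hk; simp at hk
  | cons i w ih =>
    rintro a ⟨x, hx⟩
    have hx' : contraction q i (wordMap q w x) = address q a := congrArg Subtype.val hx
    by_cases h0 : a 0 = i
    · have h1 : address q a = contraction q i (address q fun k => a (k + 1)) := by
        rw [← h0, ← address_cons, cons_head_tail]
      have h2 := contraction_injective q i (hx'.trans h1)
      rcases ih (fun k => a (k + 1)) ⟨x, Subtype.ext h2⟩ with h | ⟨N, j, h⟩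
      · left
        intro k hk
        cases k with
        | zero => simpa using h0
        | succ k => simpa using h k (by simpa using hk)
      · right
        refine ⟨N + 1, j, fun k hk => ?_⟩
        obtain ⟨k, rfl⟩ : ∃ l, k = l + 1 := ⟨k - 1, by omega⟩
        exact h k (by omega)
    · right
      obtain ⟨b, hb⟩ := (wordMap q w x).2
      rw [← hb] at hx'
      refine ⟨1, i, fun k hk => ?_⟩
      obtain ⟨k, rfl⟩ : ∃ l, k = l + 1 := ⟨k - 1, by omega⟩
      exact eq_of_mem q hq i a b h0 hx'.symm k

theorem continuous_wordMap (q : Fin 3 → Plane) (w : List (Fin 3)) : Continuous (wordMap q w) := by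
  induction w with
  | nil => exact continuous_id
  | cons i w ih =>
    have : Continuous (F q i) := by
      refine Continuous.subtype_mk ?_ _
      unfold contraction
      fun_prop
    exact this.comp ih

/-- Each cell of level `m` has measure `3^{-m}`. -/
theorem gasketMeasure_cell (q : Fin 3 → Plane) (hq : IsEquilateral q) (w : List (Fin 3)) :
    gasketMeasure q (cell q w) = (3 : ENNReal)⁻¹ ^ w.length := by
  have hm : MeasurableSet (cell q w) :=
    (isCompact_range (continuous_wordMap q w)).isClosed.measurableSet
  rw [gasketMeasure, Measure.map_apply (continuous_point q).measurable hm,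
    ← addressMeasure_cylinder w]
  apply le_antisymm
  · calc addressMeasure (point q ⁻¹' cell q w)
        ≤ addressMeasure (cylinder w ∪ evConst) := measure_mono (cylinder_of_mem_cell q hq w)
      _ ≤ addressMeasure (cylinder w) + addressMeasure evConst := measure_union_le _ _
      _ = addressMeasure (cylinder w) := by rw [countable_evConst.measure_zero, add_zero]
  · exact measure_mono (mem_cell_of_cylinder q w)

end SierpinskiGasket

end

noncomputable section

namespace SierpinskiGasket

variable {q : Fin 3 → Plane}

/-! For a fixed base point and type the monomials form a tower: each is the Laplacian of the next,
and the lowest is harmonic. Green's formula for u_j and v_{k+1} trades ⟨u_j, v_k⟩ for ⟨u_{j-1},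
v_{k+1}⟩ plus boundary terms. Iteration stops at Δu_0 = 0 and leaves a finite boundary sum
(`ip_tower`). The prescribed jet removes the terms at q_0, and reflection makes those at q_1 and q_2
equal, hence a factor 2.

It remains to express all boundary data at q_1 through α, β, η. Let α, β, γ and η, τ, κ also denote
the generating series in z of the values and normal derivatives at q_1 of the towers of type 1, 2,
3. Formally ∑ zʲ u_j is an eigenfunction with eigenvalue z, so for two towers Green's formula has no
interior term (`green_tower`). This gives 2τ = 1 - 2α and, for every tower w, 2β ∂ₙw(q_i) =
w(q_{i+1}) + w(q_{i-1}) - 2α w(q_i) (`dirichlet_to_neumann`).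

Normal derivatives cancel where two cells meet, so the midpoint values satisfy a graph eigenvalue
equation (`junction`), a formal version of spectral decimation. With the symmetries it yields α(5z)
= 4α² - 3α and 5γ(5z) = (4α + 1)γ. The series (α - 1)/z solves the second equation too, and a
solution is determined by its constant term; so γ = 3(α - 1)/z, and then κ = 3η/z. This is the
origin of 18 = 2·3².

The zero products follow from parity under the reflection fixing q_0. For type 3 the monomials of
one degree at the three base points add up to zero, and the reflection equates the two mixed
products, so each is -1/2 of the unmixed one.

The analytic basis is a comparison of consecutive graph levels (`cornerDiff_one`). It gives normal
derivatives, exact harmonicity on every graph when Δu = 0, and thereby uniqueness. -/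

theorem sum_fin_three_cyclic {M : Type*} [AddCommMonoid M] (i : Fin 3) (f : Fin 3 → M) :
    ∑ j, f j = f i + f (i + 1) + f (i - 1) := by
  rw [Fin.sum_univ_three]
  match i with
  | 0 => rfl
  | 1 => change _ = f 1 + f 2 + f 0; abel
  | 2 => change _ = f 2 + f 0 + f 1; abel

/-! ### Points of the gasket -/

theorem F_point (i : Fin 3) (a : ℕ → Fin 3) : F q i (point q a) = point q (cons i a) :=
  Subtype.ext (address_cons q i a).symm

theorem exists_point (x : gasket q) : ∃ a, point q a = x := by
  obtain ⟨x, a, rfl⟩ := x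
  exact ⟨a, rfl⟩

theorem vertex_eq_point (i : Fin 3) : vertex q i = point q fun _ => i := by
  have h := (hasSum_half.smul_const (q i)).tsum_eq
  rw [one_smul] at h
  exact Subtype.ext h.symm

theorem F_vertex_self (i : Fin 3) : F q i (vertex q i) = vertex q i := by
  refine Subtype.ext ?_
  simp [F, vertex, contraction]

theorem F_iterate_vertex_self (i : Fin 3) (n : ℕ) : (F q i)^[n] (vertex q i) = vertex q i :=
  Function.iterate_fixed (F_vertex_self i) n

theorem F_injective (i : Fin 3) : Function.Injective (F q i) := fun _ _ h =>
  Subtype.ext (contraction_injective q i (congrArg Subtype.val h))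

theorem vertex_injective (hq : IsEquilateral q) : Function.Injective (vertex q) := by
  intro i j h
  obtain ⟨d, hd, hdist⟩ := hq
  by_contra hij
  have h1 := hdist i j hij
  have h2 : q i = q j := congrArg Subtype.val h
  rw [h2, dist_self] at h1
  exact hd.ne h1

theorem F_vertex_comm (a b : Fin 3) : F q a (vertex q b) = F q b (vertex q a) := by
  refine Subtype.ext ?_
  simp only [F, vertex, contraction]
  module

/-- Two cells of level 1 meet in at most one point: by `eq_of_mem`, all digits after the first in an
address of a common point are forced. -/
theorem eq_vertex_of_F_eq_F (hq : IsEquilateral q) {c e : Fin 3} {z y : gasket q} (hce : c ≠ e)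
    (h : F q c z = F q e y) : y = vertex q c := by
  obtain ⟨t, rfl⟩ := exists_point y
  obtain ⟨b, rfl⟩ := exists_point z
  rw [F_point e t] at h
  have h1 := eq_of_mem q hq c (cons e t) b (Ne.symm hce) (congrArg Subtype.val h).symm
  rw [vertex_eq_point]
  exact congrArg _ (funext h1)

theorem F_eq_vertex (hq : IsEquilateral q) {c e : Fin 3} {y : gasket q}
    (h : F q e y = vertex q c) : e = c ∧ y = vertex q c := by
  rw [← F_vertex_self c] at h
  by_cases hec : e = c
  · subst hec
    exact ⟨rfl, F_injective _ h⟩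
  · exact absurd (vertex_injective hq (eq_vertex_of_F_eq_F hq hec h)).symm hec

theorem wordMap_replicate (b : Fin 3) (n : ℕ) :
    wordMap q (List.replicate n b) = (F q b)^[n] := by
  induction n with
  | zero => rfl
  | succ n ih => rw [List.replicate_succ, wordMap, ih, Function.iterate_succ']

/-- A boundary point is a corner of only one cell of each level; this is what identifies the
neighbours of a junction point. -/
theorem eq_replicate_of_wordMap_eq_vertex (hq : IsEquilateral q) (w : List (Fin 3)) {i c : Fin 3}
    (h : wordMap q w (vertex q i) = vertex q c) : w = List.replicate w.length c ∧ i = c := by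
  induction w with
  | nil => exact ⟨rfl, vertex_injective hq h⟩
  | cons e w ih =>
    obtain ⟨rfl, h2⟩ := F_eq_vertex hq h
    obtain ⟨h3, rfl⟩ := ih h2
    exact ⟨by rw [List.length_cons, List.replicate_succ, ← h3], rfl⟩

theorem iterate_eq_vertex (hq : IsEquilateral q) {a k c : Fin 3} {n : ℕ}
    (h : (F q a)^[n] (vertex q k) = vertex q c) : k = c := by
  rw [← wordMap_replicate] at h
  exact (eq_replicate_of_wordMap_eq_vertex hq _ h).2

/-! ### Junction points -/

theorem mem_V_zero {x : gasket q} : x ∈ V q 0 ↔ ∃ i, x = vertex q i := by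
  constructor
  · rintro ⟨w, hw, i, rfl⟩
    rw [List.length_eq_zero_iff] at hw
    subst hw
    exact ⟨i, rfl⟩
  · rintro ⟨i, rfl⟩
    exact ⟨[], rfl, i, rfl⟩

theorem F_mem_V {m : ℕ} {x : gasket q} (e : Fin 3) (hx : x ∈ V q m) : F q e x ∈ V q (m + 1) := by
  obtain ⟨w, hw, i, rfl⟩ := hx
  exact ⟨e :: w, by simp [hw], i, rfl⟩

theorem F_mem_interior (hq : IsEquilateral q) {m : ℕ} {x : gasket q} (e : Fin 3)
    (hx : x ∈ V q m \ V q 0) : F q e x ∈ V q (m + 1) \ V q 0 := by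
  refine ⟨F_mem_V e hx.1, fun h => hx.2 ?_⟩
  obtain ⟨c, h⟩ := mem_V_zero.1 h
  exact mem_V_zero.2 ⟨c, (F_eq_vertex hq h).2⟩

theorem iterate_mem_interior (hq : IsEquilateral q) {m : ℕ} {x : gasket q} (e : Fin 3) (n : ℕ)
    (hx : x ∈ V q m \ V q 0) : (F q e)^[n] x ∈ V q (m + n) \ V q 0 := by
  induction n with
  | zero => exact hx
  | succ n ih => rw [Function.iterate_succ_apply']; exact F_mem_interior hq e ih

theorem vertex_mem_V (m : ℕ) (i : Fin 3) : vertex q i ∈ V q m :=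
  ⟨List.replicate m i, by simp, i, by rw [wordMap_replicate, F_iterate_vertex_self]⟩

theorem F_vertex_mem_interior (hq : IsEquilateral q) {a b : Fin 3} (hab : a ≠ b) (n : ℕ) :
    F q a (vertex q b) ∈ V q (n + 1) \ V q 0 := by
  refine ⟨F_mem_V a (vertex_mem_V n b), fun h => ?_⟩
  obtain ⟨c, h⟩ := mem_V_zero.1 h
  obtain ⟨rfl, h2⟩ := F_eq_vertex hq h
  exact hab (vertex_injective hq h2).symm

/-- The induction step over levels: points of the first kind are handled at the previous level
through `graphLaplacian_F`, and only the midpoints of the second kind need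
`graphLaplacian_junction`. -/
theorem interior_cases {m : ℕ} {x : gasket q} (hx : x ∈ V q (m + 1) \ V q 0) :
    (∃ e, ∃ y ∈ V q m \ V q 0, x = F q e y) ∨ ∃ a b, a ≠ b ∧ x = F q a (vertex q b) := by
  have h0 := hx.2
  obtain ⟨w, hw, i, rfl⟩ := hx.1
  obtain _ | ⟨e, w⟩ := w
  · simp at hw
  by_cases hy : wordMap q w (vertex q i) ∈ V q 0
  · obtain ⟨b, hb⟩ := mem_V_zero.1 hy
    refine Or.inr ⟨e, b, fun heb => h0 ?_, congrArg (F q e) hb⟩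
    subst heb
    exact mem_V_zero.2 ⟨e, (congrArg (F q e) hb).trans (F_vertex_self e)⟩
  · exact Or.inl ⟨e, _, ⟨⟨w, by simpa using hw, i, rfl⟩, hy⟩, rfl⟩

/-! ### The graph Laplacian -/

/-- No edge at `F q e x` leaves the cell, because a cell with another first letter could touch this
point only if x were a boundary point. -/
theorem graphLaplacian_F (hq : IsEquilateral q) {m : ℕ} (u : gasket q → ℝ) {x : gasket q}
    (e : Fin 3) (hx : x ∉ V q 0) :
    graphLaplacian q (m + 1) u (F q e x) = graphLaplacian q m (u ∘ F q e) x := by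
  have h : {y | Adj q (m + 1) (F q e x) y} = F q e '' {z | Adj q m x z} := by
    ext y
    constructor
    · rintro ⟨w, hw, i, j, hij, h1, rfl⟩
      obtain _ | ⟨c, w⟩ := w
      · simp at hw
      by_cases hce : c = e
      · subst hce
        exact ⟨_, ⟨w, by simpa using hw, i, j, hij, F_injective c h1, rfl⟩, rfl⟩
      · exact absurd (mem_V_zero.2 ⟨c, eq_vertex_of_F_eq_F hq hce h1.symm⟩) hx
    · rintro ⟨z, ⟨w, hw, i, j, hij, rfl, rfl⟩, rfl⟩
      exact ⟨e :: w, by simp [hw], i, j, hij, rfl, rfl⟩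
  rw [graphLaplacian, h, finsum_mem_image (F_injective e).injOn]
  rfl

theorem graphLaplacian_iterate (hq : IsEquilateral q) {m : ℕ} (u : gasket q → ℝ) {x : gasket q}
    (e : Fin 3) (n : ℕ) (hx : x ∈ V q m \ V q 0) :
    graphLaplacian q (m + n) u ((F q e)^[n] x) = graphLaplacian q m (u ∘ (F q e)^[n]) x := by
  induction n generalizing u with
  | zero => rfl
  | succ n ih =>
    rw [Function.iterate_succ_apply', ← add_assoc,
      graphLaplacian_F hq u e (iterate_mem_interior hq e n hx).2, ih, Function.iterate_succ']
    rfl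

/-- The sum of the differences of `u` along the edges at `qᵢ` of the cell `Fᵢⁿ (SG)`. -/
def cornerDiff (q : Fin 3 → Plane) (n : ℕ) (i : Fin 3) (u : gasket q → ℝ) : ℝ :=
  ∑ j, (u (vertex q i) - u ((F q i)^[n] (vertex q j)))

theorem cornerDiff_eq (n : ℕ) (i : Fin 3) (u : gasket q → ℝ) :
    cornerDiff q n i u = 2 * u (vertex q i) - u ((F q i)^[n] (vertex q (i + 1)))
      - u ((F q i)^[n] (vertex q (i - 1))) := by
  rw [cornerDiff, sum_fin_three_cyclic i, F_iterate_vertex_self]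
  ring

theorem cornerDiff_F_self (n : ℕ) (i : Fin 3) (u : gasket q → ℝ) :
    cornerDiff q n i (u ∘ F q i) = cornerDiff q (n + 1) i u := by
  simp only [cornerDiff, Function.comp, F_vertex_self, Function.iterate_succ_apply']

theorem cornerDiff_iterate (m n : ℕ) (i : Fin 3) (u : gasket q → ℝ) :
    cornerDiff q n i (u ∘ (F q i)^[m]) = cornerDiff q (n + m) i u := by
  simp only [cornerDiff, Function.comp, F_iterate_vertex_self, ← Function.iterate_add_apply,
    add_comm]

theorem cornerDiff_erase (n : ℕ) (i : Fin 3) (u : gasket q → ℝ) :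
    ∑ j ∈ Finset.univ.erase i, (u ((F q i)^[n] (vertex q j)) - u (vertex q i))
      = -cornerDiff q n i u := by
  rw [cornerDiff, ← Finset.add_sum_erase _ _ (Finset.mem_univ i), F_iterate_vertex_self, sub_self,
    zero_add, ← Finset.sum_neg_distrib]
  simp only [neg_sub]

-- Exactly two cells of level n + 1 have the junction point as a corner, F_a F_bⁿ(SG) and F_b
-- F_aⁿ(SG), and each contributes one corner difference.
open Classical in
theorem graphLaplacian_junction (hq : IsEquilateral q) (n : ℕ) (u : gasket q → ℝ) {a b : Fin 3}
    (hab : a ≠ b) : graphLaplacian q (n + 1) u (F q a (vertex q b))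
      = -(cornerDiff q n b (u ∘ F q a) + cornerDiff q n a (u ∘ F q b)) := by
  set T : Fin 3 → Fin 3 → Finset (gasket q) := fun a b =>
    (Finset.univ.erase b).image fun j => F q a ((F q b)^[n] (vertex q j)) with hT
  have hit : ∀ b, Function.Injective ((F q b)^[n]) := fun b => (F_injective b).iterate n
  have hset : {y | Adj q (n + 1) (F q a (vertex q b)) y} = ↑(T a b ∪ T b a) := by
    ext y
    simp only [hT, Finset.coe_union, Finset.coe_image, Set.mem_union, Set.mem_image,
      Finset.mem_coe, Finset.mem_erase, Finset.mem_univ, and_true]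
    constructor
    · rintro ⟨w, hw, i, j, hij, h1, rfl⟩
      obtain _ | ⟨c, w⟩ := w
      · simp at hw
      have hl : w.length = n := by simpa using hw
      have h1 : F q a (vertex q b) = F q c (wordMap q w (vertex q i)) := h1
      by_cases hca : c = a
      · subst hca
        obtain ⟨h2, rfl⟩ := eq_replicate_of_wordMap_eq_vertex hq w (F_injective c h1).symm
        refine Or.inl ⟨j, hij.symm, ?_⟩
        rw [hl] at h2
        rw [wordMap, h2, wordMap_replicate]; rfl
      · by_cases hcb : c = b
        · subst hcb
          rw [F_vertex_comm] at h1
          obtain ⟨h2, rfl⟩ := eq_replicate_of_wordMap_eq_vertex hq w (F_injective c h1).symm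
          refine Or.inr ⟨j, hij.symm, ?_⟩
          rw [hl] at h2
          rw [wordMap, h2, wordMap_replicate]; rfl
        · exact absurd (vertex_injective hq (eq_vertex_of_F_eq_F hq hca h1.symm)).symm hcb
    · rintro (⟨j, hj, rfl⟩ | ⟨j, hj, rfl⟩)
      · exact ⟨a :: List.replicate n b, by simp, b, j, hj.symm,
          by rw [wordMap, wordMap_replicate, Function.comp, F_iterate_vertex_self],
          by rw [wordMap, wordMap_replicate]; rfl⟩
      · exact ⟨b :: List.replicate n a, by simp, a, j, hj.symm,
          by rw [wordMap, wordMap_replicate, Function.comp, F_iterate_vertex_self,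
            F_vertex_comm],
          by rw [wordMap, wordMap_replicate]; rfl⟩
  have hdisj : Disjoint (T a b) (T b a) := by
    rw [Finset.disjoint_left]
    simp only [hT, Finset.mem_image, Finset.mem_erase, Finset.mem_univ, and_true]
    rintro y ⟨j, hj, rfl⟩ ⟨k, hk, h⟩
    -- A shared neighbour would lie in both cells of level 1, hence be the junction point itself,
    -- which has been erased.
    exact hk (iterate_eq_vertex hq (eq_vertex_of_F_eq_F hq hab h.symm))
  have hsum : ∀ a b : Fin 3, ∑ y ∈ T a b, (u y - u (F q a (vertex q b)))
      = -cornerDiff q n b (u ∘ F q a) := by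
    intro a b
    rw [← cornerDiff_erase, hT, Finset.sum_image]
    · rfl
    · intro j _ k _ h
      exact vertex_injective hq (hit b (F_injective a h))
  rw [graphLaplacian, hset, finsum_mem_coe_finset, Finset.sum_union hdisj, hsum,
    F_vertex_comm a b, hsum]
  ring

theorem fin_three_ne (i : Fin 3) : i ≠ i + 1 ∧ i ≠ i - 1 ∧ i + 1 ≠ i - 1 ∧ i + 1 + 1 = i - 1 ∧
    i - 1 - 1 = i + 1 := by
  revert i; decide

theorem graphLaplacian_one (hq : IsEquilateral q) (u : gasket q → ℝ) (i : Fin 3) :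
    graphLaplacian q 1 u (F q i (vertex q (i + 1)))
      = u (vertex q i) + u (vertex q (i + 1)) + u (F q i (vertex q (i - 1)))
        + u (F q (i + 1) (vertex q (i - 1))) - 4 * u (F q i (vertex q (i + 1))) := by
  obtain ⟨h1, h2, h3, h4, h5⟩ := fin_three_ne i
  rw [graphLaplacian_junction hq 0 u h1, cornerDiff_eq, cornerDiff_eq]
  simp only [Function.iterate_zero, id, Function.comp, h4, add_sub_cancel_right, F_vertex_self]
  rw [F_vertex_comm (i + 1) i]
  ring

/-- Summation by parts against the harmonic function that is 1 at q_i and 0 at the other vertices: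
its midpoint values 2/5, 2/5, 1/5, multiplied by 5/3, are the weights. -/
theorem cornerDiff_one (hq : IsEquilateral q) (u : gasket q → ℝ) (i : Fin 3) :
    5 / 3 * cornerDiff q 1 i u - cornerDiff q 0 i u
      = 2 / 3 * (graphLaplacian q 1 u (F q i (vertex q (i + 1)))
        + graphLaplacian q 1 u (F q (i - 1) (vertex q i)))
        + 1 / 3 * graphLaplacian q 1 u (F q (i + 1) (vertex q (i - 1))) := by
  obtain ⟨h1, h2, h3, h4, h5⟩ := fin_three_ne i
  have e1 := graphLaplacian_one hq u i
  have e2 := graphLaplacian_one hq u (i - 1)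
  have e3 := graphLaplacian_one hq u (i + 1)
  simp only [h4, h5, add_sub_cancel_right, sub_add_cancel] at e1 e2 e3
  rw [F_vertex_comm (i - 1) i, F_vertex_comm (i - 1) (i + 1)] at e2
  rw [F_vertex_comm (i + 1) i, F_vertex_comm (i - 1) i] at e3
  rw [e1, F_vertex_comm (i - 1) i, e2, e3, cornerDiff_eq, cornerDiff_eq]
  simp only [Function.iterate_zero, Function.iterate_one, id]
  ring

theorem cornerDiff_succ (hq : IsEquilateral q) (u : gasket q → ℝ) (i : Fin 3) (n : ℕ) :
    5 / 3 * cornerDiff q (n + 1) i u - cornerDiff q n i u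
      = 2 / 3 * (graphLaplacian q (1 + n) u ((F q i)^[n] (F q i (vertex q (i + 1))))
        + graphLaplacian q (1 + n) u ((F q i)^[n] (F q (i - 1) (vertex q i))))
        + 1 / 3 * graphLaplacian q (1 + n) u
          ((F q i)^[n] (F q (i + 1) (vertex q (i - 1)))) := by
  obtain ⟨h1, h2, h3, h4, h5⟩ := fin_three_ne i
  have h := cornerDiff_one hq (u ∘ (F q i)^[n]) i
  rw [graphLaplacian_iterate hq u i n (F_vertex_mem_interior hq h1 0),
    graphLaplacian_iterate hq u i n (F_vertex_mem_interior hq h2.symm 0),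
    graphLaplacian_iterate hq u i n (F_vertex_mem_interior hq h3 0), ← h,
    cornerDiff_iterate, cornerDiff_iterate, zero_add, add_comm 1 n]

theorem abs_cornerDiff_succ_sub (hq : IsEquilateral q) (u : gasket q → ℝ) (i : Fin 3) (n : ℕ)
    {K : ℝ} (hK : ∀ x ∈ V q (n + 1) \ V q 0, |graphLaplacian q (n + 1) u x| ≤ K) :
    |5 / 3 * cornerDiff q (n + 1) i u - cornerDiff q n i u| ≤ 5 / 3 * K := by
  obtain ⟨h1, h2, h3, h4, h5⟩ := fin_three_ne i
  rw [cornerDiff_succ hq]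
  rw [add_comm n 1] at hK
  have b1 := abs_le.1 (hK _ (iterate_mem_interior hq i n (F_vertex_mem_interior hq h1 0)))
  have b2 := abs_le.1 (hK _ (iterate_mem_interior hq i n (F_vertex_mem_interior hq h2.symm 0)))
  have b3 := abs_le.1 (hK _ (iterate_mem_interior hq i n (F_vertex_mem_interior hq h3 0)))
  rw [abs_le]
  constructor <;> linarith [b1.1, b1.2, b2.1, b2.2, b3.1, b3.2]

/-- At a midpoint the coarser graph Laplacian is 5/3 of the finer one up to two errors of size 5/3
K, in total at most 5K. The factor 5 is exactly the one in the normalization of Δ. -/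
theorem abs_graphLaplacian_le (hq : IsEquilateral q) {m : ℕ} (u : gasket q → ℝ) {K : ℝ}
    (hK : ∀ x ∈ V q (m + 1) \ V q 0, |graphLaplacian q (m + 1) u x| ≤ K) :
    ∀ x ∈ V q m \ V q 0, |graphLaplacian q m u x| ≤ 5 * K := by
  induction m generalizing u with
  | zero => simp
  | succ m ih =>
    have hF : ∀ e, ∀ x ∈ V q (m + 1) \ V q 0,
        |graphLaplacian q (m + 1) (u ∘ F q e) x| ≤ K := fun e x hx => by
      rw [← graphLaplacian_F hq u e hx.2]
      exact hK _ (F_mem_interior hq e hx)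
    intro x hx
    rcases interior_cases hx with ⟨e, y, hy, rfl⟩ | ⟨a, b, hab, rfl⟩
    · rw [graphLaplacian_F hq u e hy.2]
      exact ih (u ∘ F q e) (hF e) y hy
    · have b1 := abs_le.1 (hK _ (F_vertex_mem_interior hq hab (m + 1)))
      have b2 := abs_le.1 (abs_cornerDiff_succ_sub hq _ b m (hF a))
      have b3 := abs_le.1 (abs_cornerDiff_succ_sub hq _ a m (hF b))
      rw [graphLaplacian_junction hq _ u hab] at b1 ⊢
      rw [abs_le]
      constructor <;> linarith [b1.1, b1.2, b2.1, b2.2, b3.1, b3.2]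

/-! ### Linearity and scaling of the Laplacian -/

theorem cornerDiff_lin (n : ℕ) (i : Fin 3) (c d : ℝ) (u v : gasket q → ℝ) :
    cornerDiff q n i (fun y => c * u y + d * v y)
      = c * cornerDiff q n i u + d * cornerDiff q n i v := by
  simp only [cornerDiff_eq]
  ring

theorem graphLaplacian_lin (hq : IsEquilateral q) {m : ℕ} (c d : ℝ) (u v : gasket q → ℝ) :
    ∀ x ∈ V q m \ V q 0, graphLaplacian q m (fun y => c * u y + d * v y) x
      = c * graphLaplacian q m u x + d * graphLaplacian q m v x := by
  induction m generalizing u v with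
  | zero => simp
  | succ m ih =>
    intro x hx
    rcases interior_cases hx with ⟨e, y, hy, rfl⟩ | ⟨a, b, hab, rfl⟩
    · rw [graphLaplacian_F hq _ e hy.2, graphLaplacian_F hq _ e hy.2,
        graphLaplacian_F hq _ e hy.2]
      exact ih (u ∘ F q e) (v ∘ F q e) y hy
    · have h := fun a b => cornerDiff_lin m b c d (u ∘ F q a) (v ∘ F q a)
      have h1 := h a b
      have h2 := h b a
      simp only [Function.comp_apply] at h1 h2
      rw [graphLaplacian_junction hq _ _ hab, graphLaplacian_junction hq _ _ hab,
        graphLaplacian_junction hq _ _ hab, Function.comp_def, Function.comp_def, h1, h2]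
      ring

theorem HasLaplacian.lin (hq : IsEquilateral q) {u v f g : C(gasket q, ℝ)}
    (hu : HasLaplacian q u f) (hv : HasLaplacian q v g) (c d : ℝ) :
    HasLaplacian q (c • u + d • v) (c • f + d • g) := by
  intro ε hε
  set K := |c| + |d| + 1 with hK
  have hK0 : 0 < K := by positivity
  obtain ⟨M, hM⟩ := hu (ε / K) (by positivity)
  obtain ⟨N, hN⟩ := hv (ε / K) (by positivity)
  refine ⟨max M N, fun m hm x hx => ?_⟩
  have h1 := hM m (le_trans (le_max_left _ _) hm) x hx
  have h2 := hN m (le_trans (le_max_right _ _) hm) x hx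
  have h3 := graphLaplacian_lin hq c d u v x hx
  have h4 : (⇑(c • u + d • v) : gasket q → ℝ) = fun y => c * u y + d * v y := rfl
  have h5 : (c • f + d • g) x = c * f x + d * g x := rfl
  rw [h4, h3, h5]
  set A := 3 / 2 * 5 ^ m * graphLaplacian q m u x - f x
  set B := 3 / 2 * 5 ^ m * graphLaplacian q m v x - g x
  calc _ = |c * A + d * B| := by congr 1; simp only [A, B]; ring
    _ ≤ |c| * |A| + |d| * |B| := by rw [← abs_mul, ← abs_mul]; exact abs_add_le _ _
    _ ≤ |c| * (ε / K) + |d| * (ε / K) := by gcongr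
    _ = (|c| + |d|) * (ε / K) := by ring
    _ < K * (ε / K) := by
      apply mul_lt_mul_of_pos_right _ (by positivity)
      rw [hK]; linarith
    _ = ε := by field_simp

theorem HasLaplacian.smul (hq : IsEquilateral q) {u f : C(gasket q, ℝ)}
    (hu : HasLaplacian q u f) (c : ℝ) : HasLaplacian q (c • u) (c • f) := by
  simpa using hu.lin hq hu c 0

theorem HasLaplacian.sub (hq : IsEquilateral q) {u v f g : C(gasket q, ℝ)}
    (hu : HasLaplacian q u f) (hv : HasLaplacian q v g) : HasLaplacian q (u - v) (f - g) := by
  simpa [sub_eq_add_neg] using hu.lin hq hv 1 (-1)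

theorem HasLaplacian.add (hq : IsEquilateral q) {u v f g : C(gasket q, ℝ)}
    (hu : HasLaplacian q u f) (hv : HasLaplacian q v g) : HasLaplacian q (u + v) (f + g) := by
  simpa using hu.lin hq hv 1 1

theorem continuous_F (i : Fin 3) : Continuous (F q i) := continuous_wordMap q [i]

/-- The contraction `Fᵢ` as a continuous map. -/
def contF (q : Fin 3 → Plane) (i : Fin 3) : C(gasket q, gasket q) := ⟨F q i, continuous_F i⟩

theorem HasLaplacian.comp_F (hq : IsEquilateral q) {u f : C(gasket q, ℝ)}
    (hu : HasLaplacian q u f) (e : Fin 3) :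
    HasLaplacian q (u.comp (contF q e)) ((1 / 5 : ℝ) • f.comp (contF q e)) := by
  intro ε hε
  obtain ⟨M, hM⟩ := hu (5 * ε) (by positivity)
  refine ⟨M, fun m hm x hx => ?_⟩
  have h := hM (m + 1) (by omega) _ (F_mem_interior hq e hx)
  rw [graphLaplacian_F hq _ e hx.2] at h
  have h1 : (⇑(u.comp (contF q e)) : gasket q → ℝ) = u ∘ F q e := rfl
  have h2 : ((1 / 5 : ℝ) • f.comp (contF q e)) x = 1 / 5 * f (F q e x) := rfl
  rw [h1, h2]
  rw [abs_lt] at h ⊢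
  rw [pow_succ] at h
  constructor <;> linarith [h.1, h.2]

theorem HasLaplacian.bound {u f : C(gasket q, ℝ)} (hu : HasLaplacian q u f) :
    ∃ M : ℕ, ∃ C : ℝ, ∀ m, M ≤ m → ∀ x ∈ V q m \ V q 0,
      |graphLaplacian q m u x| ≤ C * (1 / 5) ^ m := by
  obtain ⟨M, hM⟩ := hu 1 one_pos
  refine ⟨M, 2 / 3 * (‖f‖ + 1), fun m hm x hx => ?_⟩
  have h := abs_lt.1 (hM m hm x hx)
  have hf := abs_le.1 (f.norm_coe_le_norm x)
  have h5 : (0 : ℝ) < 5 ^ m := by positivity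
  have : |5 ^ m * graphLaplacian q m u x| ≤ 2 / 3 * (‖f‖ + 1) := by
    rw [abs_le]
    constructor <;> linarith [h.1, h.2, hf.1, hf.2]
  rw [abs_mul, abs_of_pos h5] at this
  rw [one_div, inv_pow, ← div_eq_mul_inv, le_div_iff₀ h5]
  linarith

/-! ### Normal derivatives -/

theorem hasNormalDeriv_iff {u : gasket q → ℝ} {i : Fin 3} {d : ℝ} :
    HasNormalDeriv q u i d
      ↔ Tendsto (fun m : ℕ => (5 / 3 : ℝ) ^ m * cornerDiff q m i u) atTop (𝓝 d) := by
  simp only [HasNormalDeriv, cornerDiff_eq]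

/-- The value of the normal derivative at `qᵢ`. -/
def normalDeriv (q : Fin 3 → Plane) (u : gasket q → ℝ) (i : Fin 3) : ℝ :=
  limUnder atTop fun m : ℕ => (5 / 3 : ℝ) ^ m * cornerDiff q m i u

theorem HasNormalDeriv.normalDeriv_eq {u : gasket q → ℝ} {i : Fin 3} {d : ℝ}
    (h : HasNormalDeriv q u i d) : normalDeriv q u i = d :=
  (hasNormalDeriv_iff.1 h).limUnder_eq

theorem HasLaplacian.hasNormalDeriv (hq : IsEquilateral q) {u f : C(gasket q, ℝ)}
    (hu : HasLaplacian q u f) (i : Fin 3) : HasNormalDeriv q u i (normalDeriv q u i) := by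
  obtain ⟨M, C, hC⟩ := hu.bound
  rw [hasNormalDeriv_iff]
  suffices h : CauchySeq fun n => (5 / 3 : ℝ) ^ (n + M) * cornerDiff q (n + M) i u by
    obtain ⟨l, hl⟩ := cauchySeq_tendsto_of_complete h
    exact tendsto_nhds_limUnder ⟨l, (tendsto_add_atTop_iff_nat
      (f := fun m : ℕ => (5 / 3 : ℝ) ^ m * cornerDiff q m i u) M).1 hl⟩
  -- The increment at level m is at most (5/3)^m · (5/3) · C 5^{-(m+1)} = (C/3) 3^{-m}; the shift by
  -- M starts where the bound is valid.
  refine cauchySeq_of_le_geometric (1 / 3) ((1 / 3) ^ M * (C / 3)) (by norm_num) fun n => ?_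
  have h := abs_cornerDiff_succ_sub hq u i (n + M) (hC (n + M + 1) (by omega))
  have h1 : n + 1 + M = n + M + 1 := by ring
  rw [h1, dist_comm, Real.dist_eq]
  calc _ = (5 / 3) ^ (n + M) * |5 / 3 * cornerDiff q (n + M + 1) i u
          - cornerDiff q (n + M) i u| := by
        rw [← abs_of_nonneg (by positivity : (0 : ℝ) ≤ (5 / 3) ^ (n + M)), ← abs_mul,
          abs_of_nonneg (by positivity : (0 : ℝ) ≤ (5 / 3) ^ (n + M))]
        congr 1
        ring
    _ ≤ (5 / 3) ^ (n + M) * (5 / 3 * (C * (1 / 5) ^ (n + M + 1))) := by gcongr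
    _ = ((5 / 3) * (1 / 5)) ^ (n + M) * (C / 3) := by rw [mul_pow]; ring
    _ = _ := by rw [show (5 / 3 * (1 / 5) : ℝ) = 1 / 3 by norm_num, pow_add]; ring

theorem normalDeriv_lin {u v : gasket q → ℝ} {i : Fin 3} {a b : ℝ}
    (hu : HasNormalDeriv q u i a) (hv : HasNormalDeriv q v i b) (c d : ℝ) :
    HasNormalDeriv q (fun y => c * u y + d * v y) i (c * a + d * b) := by
  rw [hasNormalDeriv_iff] at *
  refine ((hu.const_mul c).add (hv.const_mul d)).congr fun m => ?_
  rw [cornerDiff_lin]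
  ring

theorem HasTangentialDeriv.lin {u v : gasket q → ℝ} {i : Fin 3} {a b : ℝ}
    (hu : HasTangentialDeriv q u i a) (hv : HasTangentialDeriv q v i b) (c d : ℝ) :
    HasTangentialDeriv q (fun y => c * u y + d * v y) i (c * a + d * b) := by
  refine ((hu.const_mul c).add (hv.const_mul d)).congr fun m => ?_
  ring

theorem HasNormalDeriv.comp_F {u : gasket q → ℝ} {i : Fin 3} {a : ℝ}
    (hu : HasNormalDeriv q u i a) : HasNormalDeriv q (u ∘ F q i) i (3 / 5 * a) := by
  rw [hasNormalDeriv_iff] at *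
  refine (((tendsto_add_atTop_iff_nat 1).2 hu).const_mul (3 / 5)).congr fun m => ?_
  rw [cornerDiff_F_self, pow_succ]
  ring

theorem HasTangentialDeriv.comp_F {u : gasket q → ℝ} {i : Fin 3} {a : ℝ}
    (hu : HasTangentialDeriv q u i a) : HasTangentialDeriv q (u ∘ F q i) i (1 / 5 * a) := by
  refine (((tendsto_add_atTop_iff_nat 1).2 hu).const_mul (1 / 5)).congr fun m => ?_
  simp only [Function.comp, ← Function.iterate_succ_apply', pow_succ]
  ring

/-- The matching condition: at a junction point the normal derivatives from the two cells that
meet there add up to zero. -/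
theorem HasLaplacian.matching (hq : IsEquilateral q) {u f : C(gasket q, ℝ)}
    (hu : HasLaplacian q u f) {a b : Fin 3} (hab : a ≠ b) :
    normalDeriv q (u.comp (contF q a)) b + normalDeriv q (u.comp (contF q b)) a = 0 := by
  have h1 := hasNormalDeriv_iff.1 ((hu.comp_F hq a).hasNormalDeriv hq b)
  have h2 := hasNormalDeriv_iff.1 ((hu.comp_F hq b).hasNormalDeriv hq a)
  -- The sum of the two sequences is -(5/3)^m times the graph Laplacian of level m + 1 at the
  -- junction point, which is of order 3^{-m}.
  refine tendsto_nhds_unique (h1.add h2) ?_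
  obtain ⟨M, C, hC⟩ := hu.bound
  have h0 : Tendsto (fun m : ℕ => C / 5 * (1 / 3 : ℝ) ^ m) atTop (𝓝 0) := by
    simpa using (tendsto_pow_atTop_nhds_zero_of_lt_one (by norm_num : (0 : ℝ) ≤ 1 / 3)
      (by norm_num)).const_mul (C / 5)
  refine squeeze_zero_norm' ?_ h0
  filter_upwards [eventually_ge_atTop M] with m hm
  have h := hC (m + 1) (by omega) _ (F_vertex_mem_interior hq hab m)
  rw [graphLaplacian_junction hq _ _ hab, abs_neg] at h
  have h3 : ∀ a, (⇑(u.comp (contF q a)) : gasket q → ℝ) = u ∘ F q a := fun _ => rfl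
  rw [← mul_add, h3, h3, norm_mul, Real.norm_of_nonneg (by positivity)]
  calc _ ≤ (5 / 3 : ℝ) ^ m * (C * (1 / 5) ^ (m + 1)) := by gcongr; exact h
    _ = C / 5 * ((5 / 3) * (1 / 5)) ^ m := by rw [mul_pow]; ring
    _ = _ := by norm_num

/-! ### Harmonic functions -/

/-- `u` is harmonic on all the graphs `Γ_m`. -/
def GraphHarmonic (q : Fin 3 → Plane) (u : gasket q → ℝ) : Prop :=
  ∀ m, ∀ x ∈ V q m \ V q 0, graphLaplacian q m u x = 0

theorem GraphHarmonic.comp_F (hq : IsEquilateral q) {u : gasket q → ℝ} (hu : GraphHarmonic q u)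
    (e : Fin 3) : GraphHarmonic q (u ∘ F q e) := fun m x hx => by
  rw [← graphLaplacian_F hq u e hx.2]
  exact hu _ _ (F_mem_interior hq e hx)

theorem abs_graphLaplacian_le_pow (hq : IsEquilateral q) {m : ℕ} (u : gasket q → ℝ) (k : ℕ) {K : ℝ}
    (hK : ∀ x ∈ V q (m + k) \ V q 0, |graphLaplacian q (m + k) u x| ≤ K) :
    ∀ x ∈ V q m \ V q 0, |graphLaplacian q m u x| ≤ 5 ^ k * K := by
  induction k generalizing K with
  | zero => simpa using hK
  | succ k ih =>
    intro x hx
    have := ih (abs_graphLaplacian_le hq u hK) x hx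
    rw [pow_succ]
    linarith

/-- Coarsening by k levels costs the factor 5^k, no more than the normalization gains, so a
renormalized limit 0 forces every graph Laplacian to vanish exactly. -/
theorem HasLaplacian.graphHarmonic (hq : IsEquilateral q) {u : C(gasket q, ℝ)}
    (hu : HasLaplacian q u 0) : GraphHarmonic q u := by
  intro m x hx
  by_contra hne
  have hpos : 0 < |graphLaplacian q m u x| := abs_pos.2 hne
  -- With ε the supposed nonzero absolute value at level m, the bound at level m + M, carried back
  -- to level m, is at most 2/3 of that value.
  obtain ⟨M, hM⟩ := hu (|graphLaplacian q m u x|) hpos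
  have h := abs_graphLaplacian_le_pow hq (m := m) u M
    (K := |graphLaplacian q m u x| * (2 / 3) * (1 / 5) ^ (m + M)) ?_ x hx
  · have h1 : (5 : ℝ) ^ M * (|graphLaplacian q m u x| * (2 / 3) * (1 / 5) ^ (m + M))
        = |graphLaplacian q m u x| * (2 / 3) * (1 / 5) ^ m * (5 * (1 / 5)) ^ M := by
      rw [mul_pow, pow_add]; ring
    have h2 : ((1 : ℝ) / 5) ^ m ≤ 1 := pow_le_one₀ (by norm_num) (by norm_num)
    rw [h1, show (5 * (1 / 5) : ℝ) = 1 by norm_num, one_pow, mul_one] at h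
    have h3 : |graphLaplacian q m u x| * (2 / 3) * (1 / 5) ^ m
        ≤ |graphLaplacian q m u x| * (2 / 3) * 1 := by gcongr
    linarith
  · intro y hy
    have h5 : (0 : ℝ) < 5 ^ (m + M) := by positivity
    have h := hM (m + M) (by omega) y hy
    rw [ContinuousMap.zero_apply, sub_zero, abs_mul, abs_of_pos (by positivity)] at h
    rw [one_div, inv_pow, ← div_eq_mul_inv, le_div_iff₀ h5]
    linarith

theorem GraphHarmonic.scaled_cornerDiff (hq : IsEquilateral q) {u : gasket q → ℝ}
    (hu : GraphHarmonic q u) (i : Fin 3) (n : ℕ) :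
    (5 / 3 : ℝ) ^ n * cornerDiff q n i u = cornerDiff q 0 i u := by
  induction n with
  | zero => simp
  | succ n ih =>
    have h := abs_cornerDiff_succ_sub hq u i n (K := 0) fun x hx => by rw [hu _ x hx, abs_zero]
    rw [mul_zero, abs_nonpos_iff, sub_eq_zero] at h
    rw [← ih, ← h]
    ring

theorem GraphHarmonic.hasNormalDeriv (hq : IsEquilateral q) {u : gasket q → ℝ}
    (hu : GraphHarmonic q u) (i : Fin 3) :
    HasNormalDeriv q u i (2 * u (vertex q i) - u (vertex q (i + 1)) - u (vertex q (i - 1))) := by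
  rw [hasNormalDeriv_iff]
  simp only [hu.scaled_cornerDiff hq]
  rw [cornerDiff_eq]
  exact tendsto_const_nhds

/-- The 1/5–2/5 rule, obtained by solving the three linear equations at the midpoints. -/
theorem GraphHarmonic.level_one (hq : IsEquilateral q) {u : gasket q → ℝ}
    (hu : GraphHarmonic q u) (i : Fin 3) :
    5 * u (F q i (vertex q (i + 1)))
      = 2 * u (vertex q i) + 2 * u (vertex q (i + 1)) + u (vertex q (i - 1)) := by
  obtain ⟨h1, h2, h3, h4, h5⟩ := fin_three_ne i
  have e1 := graphLaplacian_one hq u i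
  have e2 := graphLaplacian_one hq u (i - 1)
  have e3 := graphLaplacian_one hq u (i + 1)
  simp only [h4, h5, add_sub_cancel_right, sub_add_cancel] at e1 e2 e3
  rw [hu 1 _ (F_vertex_mem_interior hq h1 0)] at e1
  rw [hu 1 _ (F_vertex_mem_interior hq h2.symm 0), F_vertex_comm (i - 1) i,
    F_vertex_comm (i - 1) (i + 1)] at e2
  rw [hu 1 _ (F_vertex_mem_interior hq h3 0), F_vertex_comm (i + 1) i,
    F_vertex_comm (i - 1) i] at e3
  linarith

/-- By the 1/5–2/5 rule each contraction multiplies the difference by exactly 1/5, so the sequence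
defining the tangential derivative is constant. -/
theorem GraphHarmonic.tangential (hq : IsEquilateral q) {u : gasket q → ℝ}
    (hu : GraphHarmonic q u) (i : Fin 3) (n : ℕ) :
    (5 : ℝ) ^ n * (u ((F q i)^[n] (vertex q (i + 1))) - u ((F q i)^[n] (vertex q (i - 1))))
      = u (vertex q (i + 1)) - u (vertex q (i - 1)) := by
  induction n generalizing u with
  | zero => simp
  | succ n ih =>
    obtain ⟨h1, h2, h3, h4, h5⟩ := fin_three_ne i
    have h := ih (hu.comp_F hq i)
    have e1 := hu.level_one hq i
    have e2 := hu.level_one hq (i - 1)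
    rw [sub_add_cancel, h5, F_vertex_comm (i - 1) i] at e2
    simp only [Function.iterate_succ_apply', Function.comp_apply] at h ⊢
    rw [pow_succ]
    linarith

theorem GraphHarmonic.hasTangentialDeriv (hq : IsEquilateral q) {u : gasket q → ℝ}
    (hu : GraphHarmonic q u) (i : Fin 3) :
    HasTangentialDeriv q u i (u (vertex q (i + 1)) - u (vertex q (i - 1))) := by
  simp only [HasTangentialDeriv, hu.tangential hq]
  exact tendsto_const_nhds

theorem GraphHarmonic.wordMap_eq_zero (hq : IsEquilateral q) {u : gasket q → ℝ}
    (hu : GraphHarmonic q u) (h0 : ∀ i, u (vertex q i) = 0) (w : List (Fin 3)) (i : Fin 3) :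
    u (wordMap q w (vertex q i)) = 0 := by
  induction w generalizing u with
  | nil => exact h0 i
  | cons e w ih =>
    refine ih (hu.comp_F hq e) fun j => ?_
    change u (F q e (vertex q j)) = 0
    have h : ∀ i, u (F q i (vertex q (i + 1))) = 0 := fun i => by
      have := hu.level_one hq i
      rw [h0, h0, h0] at this
      linarith
    rcases (by revert e j; decide : j = e ∨ j = e + 1 ∨ e = j + 1) with rfl | rfl | rfl
    · rw [F_vertex_self, h0]
    · exact h e
    · rw [F_vertex_comm, h j]

/-! ### Density of the vertices and uniqueness of harmonic functions -/

theorem dist_wordMap (w : List (Fin 3)) (x y : gasket q) :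
    dist (wordMap q w x) (wordMap q w y) = (1 / 2) ^ w.length * dist x y := by
  induction w with
  | nil => simp [wordMap]
  | cons e w ih =>
    have h : ∀ x y : gasket q, dist (F q e x) (F q e y) = 1 / 2 * dist x y := fun x y => by
      simp only [Subtype.dist_eq, F, contraction]
      rw [dist_add_right, dist_smul₀, dist_sub_right]
      norm_num
    simp only [wordMap, Function.comp_apply]
    rw [h, ih, List.length_cons, pow_succ]
    ring

theorem exists_wordMap (m : ℕ) (x : gasket q) :
    ∃ w : List (Fin 3), w.length = m ∧ ∃ y, x = wordMap q w y := by
  induction m generalizing x with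
  | zero => exact ⟨[], rfl, x, rfl⟩
  | succ m ih =>
    obtain ⟨a, rfl⟩ := exists_point x
    obtain ⟨w, hw, y, hy⟩ := ih (point q fun k => a (k + 1))
    refine ⟨a 0 :: w, by simp [hw], y, ?_⟩
    rw [wordMap, Function.comp_apply, ← hy, F_point, cons_head_tail]

theorem exists_oscillation_le (φ : C(gasket q, ℝ)) {ε : ℝ} (hε : 0 < ε) :
    ∃ M : ℕ, ∀ m, M ≤ m → ∀ w : List (Fin 3), w.length = m → ∀ x y,
      |φ (wordMap q w x) - φ (wordMap q w y)| ≤ ε := by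
  obtain ⟨δ, hδ, h⟩ := Metric.uniformContinuous_iff.1
    (CompactSpace.uniformContinuous_of_continuous φ.continuous) ε hε
  set D := Metric.diam (Set.univ : Set (gasket q)) with hD
  have hlim : Tendsto (fun m : ℕ => (1 / 2 : ℝ) ^ m * D) atTop (𝓝 0) := by
    simpa using (tendsto_pow_atTop_nhds_zero_of_lt_one (by norm_num : (0 : ℝ) ≤ 1 / 2)
      (by norm_num)).mul_const D
  obtain ⟨M, hM⟩ := eventually_atTop.1 (hlim.eventually_lt_const hδ)
  refine ⟨M, fun m hm w hw x y => (h ?_).le⟩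
  rw [dist_wordMap, hw]
  refine lt_of_le_of_lt ?_ (hM m hm)
  gcongr
  exact Metric.dist_le_diam_of_mem Metric.isBounded_of_compactSpace (Set.mem_univ _)
    (Set.mem_univ _)

theorem eq_zero_of_harmonic (hq : IsEquilateral q) {u : C(gasket q, ℝ)}
    (hu : HasLaplacian q u 0) (h0 : ∀ i, u (vertex q i) = 0) : u = 0 := by
  ext x
  rw [ContinuousMap.zero_apply, ← abs_nonpos_iff]
  refine le_of_forall_pos_le_add fun ε hε => ?_
  obtain ⟨M, hM⟩ := exists_oscillation_le u hε
  obtain ⟨w, hw, y, rfl⟩ := exists_wordMap M x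
  have := hM M le_rfl w hw y (vertex q 0)
  rwa [(hu.graphHarmonic hq).wordMap_eq_zero hq h0, sub_zero, ← zero_add ε] at this

/-- For a harmonic function the value and the two derivatives at one boundary point are linear in
the three boundary values and determine them. -/
theorem eq_zero_of_harmonic_of_jet (hq : IsEquilateral q) {u : C(gasket q, ℝ)}
    (hu : HasLaplacian q u 0) {n : Fin 3} (h0 : u (vertex q n) = 0)
    (h1 : HasNormalDeriv q u n 0) (h2 : HasTangentialDeriv q u n 0) : u = 0 := by
  have hh := hu.graphHarmonic hq
  have e1 := tendsto_nhds_unique h1 (hh.hasNormalDeriv hq n)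
  have e2 := tendsto_nhds_unique h2 (hh.hasTangentialDeriv hq n)
  refine eq_zero_of_harmonic hq hu fun i => ?_
  rcases (show ∀ n i : Fin 3, i = n ∨ i = n + 1 ∨ i = n - 1 by decide) n i with rfl | rfl | rfl <;>
    linarith

/-! ### Self-similarity of the measure -/

theorem measurable_cons (i : Fin 3) : Measurable (cons i) := by
  refine measurable_pi_iff.2 fun k => ?_
  cases k
  · exact measurable_const
  · exact measurable_pi_apply _

/-- A product measure is determined by boxes, and prescribing the first digit leaves the remaining
digits distributed as before. -/
theorem addressMeasure_self_similar :
    ∑ i : Fin 3, (3 : ENNReal)⁻¹ • addressMeasure.map (cons i) = addressMeasure := by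
  classical
  set μ := (PMF.uniformOfFintype (Fin 3)).toMeasure with hμ
  refine Measure.eq_infinitePi _ fun s t ht => ?_
  set N := s.sup id with hN
  have hsN : s ⊆ Finset.range (N + 1) := fun k hk =>
    Finset.mem_range.2 (Nat.lt_succ_of_le (Finset.le_sup (f := id) hk))
  -- Padding with the full set makes the box depend on an initial segment of digits, so that
  -- removing the first digit is a shift of the index.
  set t' : ℕ → Set (Fin 3) := fun k => if k ∈ s then t k else Set.univ with ht'
  have hpi : Set.pi s t = Set.pi (Finset.range (N + 1)) t' := by
    ext a
    simp only [Set.mem_pi, Finset.mem_coe, ht']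
    constructor
    · intro h k _
      split_ifs with hk
      · exact h k hk
      · trivial
    · intro h k hk
      have := h k (hsN hk)
      rwa [if_pos hk] at this
  have hprod : ∏ i ∈ s, μ (t i) = ∏ i ∈ Finset.range (N + 1), μ (t' i) := by
    rw [← Finset.prod_subset hsN]
    · exact Finset.prod_congr rfl fun k hk => by rw [ht']; simp only [if_pos hk]
    · intro k _ hk
      simp only [ht', if_neg hk, measure_univ]
  have hmeas : MeasurableSet (Set.pi (Finset.range (N + 1) : Set ℕ) t') :=
    MeasurableSet.pi (Finset.countable_toSet _) fun _ _ => MeasurableSet.of_discrete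
  have hpre : ∀ i : Fin 3, addressMeasure (cons i ⁻¹' Set.pi (Finset.range (N + 1) : Set ℕ) t')
      = (t' 0).indicator 1 i * ∏ k ∈ Finset.range N, μ (t' (k + 1)) := by
    intro i
    by_cases hi : i ∈ t' 0
    · rw [Set.indicator_of_mem hi, Pi.one_apply, one_mul,
        ← Measure.infinitePi_pi _ (fun _ _ => MeasurableSet.of_discrete), addressMeasure]
      congr 1
      ext a
      simp only [Set.mem_preimage, Set.mem_pi, Finset.mem_coe, Finset.mem_range]
      constructor
      · intro h k hk
        exact h (k + 1) (by omega)
      · intro h k hk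
        cases k with
        | zero => exact hi
        | succ k => exact h k (by omega)
    · rw [Set.indicator_of_notMem hi, zero_mul]
      convert measure_empty (μ := addressMeasure)
      ext a
      simp only [Set.mem_preimage, Set.mem_pi, Finset.mem_coe, Finset.mem_range,
        Set.mem_empty_iff_false, iff_false]
      intro h
      exact hi (h 0 (by omega))
  rw [hprod, hpi, Measure.coe_finsetSum, Finset.sum_apply]
  simp only [Measure.smul_apply, smul_eq_mul, Measure.map_apply (measurable_cons _) hmeas, hpre]
  rw [Finset.prod_range_succ', mul_comm, hμ, PMF.toMeasure_apply_fintype, Finset.sum_mul]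
  refine Finset.sum_congr rfl fun i _ => ?_
  rw [← mul_assoc]
  congr 1
  by_cases hi : i ∈ t' 0
  · simp [Set.indicator_of_mem hi]
  · simp [Set.indicator_of_notMem hi]

theorem integral_self_similar (φ : C(gasket q, ℝ)) :
    ∫ x, φ x ∂gasketMeasure q
      = 1 / 3 * ∑ i, ∫ x, φ.comp (contF q i) x ∂gasketMeasure q := by
  have hmap : ∀ ψ : C(gasket q, ℝ), ∫ x, ψ x ∂gasketMeasure q
      = ∫ a, ψ (point q a) ∂addressMeasure := fun ψ =>
    integral_map (continuous_point q).measurable.aemeasurable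
      ψ.continuous.aestronglyMeasurable
  simp only [hmap]
  have hm : ∀ i, Integrable (fun a => φ (point q a))
      ((3 : ENNReal)⁻¹ • addressMeasure.map (cons i)) := by
    intro i
    have : IsProbabilityMeasure (addressMeasure.map (cons i)) :=
      Measure.isProbabilityMeasure_map (measurable_cons i).aemeasurable
    refine Integrable.smul_measure ?_ (by simp)
    refine Integrable.of_bound
      ((φ.continuous.comp (continuous_point q)).aestronglyMeasurable) ‖φ‖ ?_
    exact Eventually.of_forall fun _ => φ.norm_coe_le_norm _
  conv_lhs => rw [← addressMeasure_self_similar]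
  rw [integral_finsetSum_measure fun i _ => hm i, Finset.mul_sum]
  refine Finset.sum_congr rfl fun i _ => ?_
  have h : ∫ a, φ (point q a) ∂addressMeasure.map (cons i)
      = ∫ a, φ (point q (cons i a)) ∂addressMeasure :=
    integral_map (f := fun a => φ (point q a)) (measurable_cons i).aemeasurable
      ((φ.continuous.comp (continuous_point q)).aestronglyMeasurable)
  rw [integral_smul_measure, h]
  simp only [← F_point]
  norm_num
  rfl

theorem integrable_continuousMap (φ : C(gasket q, ℝ)) : Integrable φ (gasketMeasure q) :=
  Integrable.of_bound φ.continuous.aestronglyMeasurable ‖φ‖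
    (Eventually.of_forall fun _ => φ.norm_coe_le_norm _)

/-! ### Sums over the cells and the junction points -/

/-- The sum of the values of `φ` at all corners of all cells of level `m`. -/
def cellSum (q : Fin 3 → Plane) : ℕ → (gasket q → ℝ) → ℝ
  | 0, φ => ∑ i, φ (vertex q i)
  | m + 1, φ => ∑ e, cellSum q m (φ ∘ F q e)

/-- The sum of the values of `φ` at the points of `V_m \ V_0`. -/
def interiorSum (q : Fin 3 → Plane) : ℕ → (gasket q → ℝ) → ℝ
  | 0, _ => 0
  | m + 1, φ => ∑ e, interiorSum q m (φ ∘ F q e) + ∑ e, φ (F q e (vertex q (e + 1)))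

/-- The unscaled graph energy of `u` and `v` on `Γ_m`. -/
def energySum (q : Fin 3 → Plane) : ℕ → (gasket q → ℝ) → (gasket q → ℝ) → ℝ
  | 0, u, v => ∑ i, u (vertex q i) * cornerDiff q 0 i v
  | m + 1, u, v => ∑ e, energySum q m (u ∘ F q e) (v ∘ F q e)

theorem energySum_comm (m : ℕ) (u v : gasket q → ℝ) : energySum q m u v = energySum q m v u := by
  induction m generalizing u v with
  | zero =>
    simp only [energySum, cornerDiff, Fin.sum_univ_three, Function.iterate_zero, id]
    ring
  | succ m ih => simp only [energySum, ih]

/-- A sum over ordered pairs of indices, split into the diagonal and pairs of opposite pairs. -/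
theorem sum_pairs (f : Fin 3 → Fin 3 → ℝ) :
    ∑ a, ∑ b, f a b = ∑ a, f a a + ∑ e, (f e (e + 1) + f (e + 1) e) := by
  simp only [Fin.sum_univ_three]
  have h1 : (0 + 1 : Fin 3) = 1 := rfl
  have h2 : (1 + 1 : Fin 3) = 2 := rfl
  have h3 : (2 + 1 : Fin 3) = 0 := rfl
  rw [h1, h2, h3]
  ring

/-- A point of V_m \ V_0 is a corner of two cells of level m, a point of V_0 of only one. -/
theorem cellSum_eq (m : ℕ) (φ : gasket q → ℝ) :
    cellSum q m φ = 2 * interiorSum q m φ + ∑ i, φ (vertex q i) := by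
  induction m generalizing φ with
  | zero => simp [cellSum, interiorSum]
  | succ m ih =>
    simp only [cellSum, interiorSum, ih, Finset.sum_add_distrib, Function.comp_apply]
    rw [sum_pairs fun a b => φ (F q a (vertex q b)), ← Finset.mul_sum]
    have : ∀ e : Fin 3, φ (F q (e + 1) (vertex q e)) = φ (F q e (vertex q (e + 1))) := fun e => by
      rw [F_vertex_comm]
    simp only [F_vertex_self, this, Finset.sum_add_distrib]
    ring

theorem interiorSum_congr (hq : IsEquilateral q) {m : ℕ} {φ ψ : gasket q → ℝ}
    (h : ∀ x ∈ V q m \ V q 0, φ x = ψ x) : interiorSum q m φ = interiorSum q m ψ := by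
  induction m generalizing φ ψ with
  | zero => rfl
  | succ m ih =>
    simp only [interiorSum]
    congr 1
    · exact Finset.sum_congr rfl fun e _ => ih fun x hx => h _ (F_mem_interior hq e hx)
    · exact Finset.sum_congr rfl fun e _ => h _ (F_vertex_mem_interior hq (fin_three_ne e).1 m)

/-- The factor 3/2 (3^m - 1) is the number of points of V_m \ V_0. -/
theorem abs_interiorSum_le (hq : IsEquilateral q) {m : ℕ} {φ : gasket q → ℝ} {K : ℝ}
    (h : ∀ x ∈ V q m \ V q 0, |φ x| ≤ K) :
    |interiorSum q m φ| ≤ 3 / 2 * (3 ^ m - 1) * K := by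
  induction m generalizing φ with
  | zero => simp [interiorSum]
  | succ m ih =>
    simp only [interiorSum]
    have h1 : ∀ e ∈ Finset.univ, |interiorSum q m (φ ∘ F q e)| ≤ 3 / 2 * (3 ^ m - 1) * K :=
      fun e _ => ih fun x hx => h _ (F_mem_interior hq e hx)
    have h2 : ∀ e ∈ Finset.univ, |φ (F q e (vertex q (e + 1)))| ≤ K :=
      fun e _ => h _ (F_vertex_mem_interior hq (fin_three_ne e).1 m)
    have h3 := (Finset.abs_sum_le_sum_abs _ _).trans (Finset.sum_le_sum h1)
    have h4 := (Finset.abs_sum_le_sum_abs _ _).trans (Finset.sum_le_sum h2)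
    simp only [Finset.sum_const, Finset.card_univ, Fintype.card_fin, nsmul_eq_mul] at h3 h4
    refine (abs_add_le _ _).trans ((add_le_add h3 h4).trans_eq ?_)
    push_cast
    ring

theorem interiorSum_lin (m : ℕ) (c d : ℝ) (φ ψ : gasket q → ℝ) :
    interiorSum q m (fun x => c * φ x + d * ψ x)
      = c * interiorSum q m φ + d * interiorSum q m ψ := by
  induction m generalizing φ ψ with
  | zero => simp [interiorSum]
  | succ m ih =>
    have h : ∀ e, interiorSum q m ((fun x => c * φ x + d * ψ x) ∘ F q e)
      = c * interiorSum q m (φ ∘ F q e) + d * interiorSum q m (ψ ∘ F q e) := fun e => ih _ _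
    simp only [interiorSum, h, Fin.sum_univ_three]
    ring

/-- There are 3^{m+1} corner values of equal weight; each is within ε of the mean of φ over its
cell, and all cells have the same mass. -/
theorem abs_cellSum_sub_integral_le {m : ℕ} (φ : C(gasket q, ℝ)) {ε : ℝ}
    (h : ∀ w : List (Fin 3), w.length = m → ∀ x y,
      |φ (wordMap q w x) - φ (wordMap q w y)| ≤ ε) :
    |(1 / 3) ^ (m + 1) * cellSum q m φ - ∫ x, φ x ∂gasketMeasure q| ≤ ε := by
  induction m generalizing φ with
  | zero =>
    have h0 : ∀ x i, |φ (vertex q i) - φ x| ≤ ε := fun x i => h [] rfl _ _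
    have hi : ∀ i, |φ (vertex q i) - ∫ x, φ x ∂gasketMeasure q| ≤ ε := fun i => by
      have hc : φ (vertex q i) = ∫ x, φ (vertex q i) ∂gasketMeasure q := by simp
      rw [hc, ← integral_sub (integrable_const _) (integrable_continuousMap φ)]
      refine (abs_integral_le_integral_abs).trans ?_
      calc ∫ x, |φ (vertex q i) - φ x| ∂gasketMeasure q ≤ ∫ x, ε ∂gasketMeasure q :=
            integral_mono_of_nonneg (Eventually.of_forall fun _ => abs_nonneg _)
              (integrable_const _) (Eventually.of_forall fun x => h0 x i)
        _ = ε := by simp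
    have b0 := abs_le.1 (hi 0)
    have b1 := abs_le.1 (hi 1)
    have b2 := abs_le.1 (hi 2)
    simp only [cellSum, Fin.sum_univ_three]
    rw [abs_le]
    constructor <;> linarith [b0.1, b0.2, b1.1, b1.2, b2.1, b2.2]
  | succ m ih =>
    have hi := fun e => abs_le.1 (ih (φ.comp (contF q e)) fun w hw x y =>
      h (e :: w) (by simp [hw]) x y)
    rw [integral_self_similar]
    simp only [cellSum, Fin.sum_univ_three]
    have h3 : ∀ e, cellSum q m (φ ∘ F q e) = cellSum q m (φ.comp (contF q e)) := fun _ => rfl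
    simp only [h3]
    rw [pow_succ (1 / 3 : ℝ) (m + 1), abs_le]
    have b0 := hi 0
    have b1 := hi 1
    have b2 := hi 2
    constructor <;> linarith [b0.1, b0.2, b1.1, b1.2, b2.1, b2.2]

theorem tendsto_cellSum (φ : C(gasket q, ℝ)) :
    Tendsto (fun m : ℕ => (1 / 3 : ℝ) ^ (m + 1) * cellSum q m φ) atTop
      (𝓝 (∫ x, φ x ∂gasketMeasure q)) := by
  rw [Metric.tendsto_atTop]
  intro ε hε
  obtain ⟨M, hM⟩ := exists_oscillation_le φ (half_pos hε)
  refine ⟨M, fun m hm => ?_⟩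
  rw [Real.dist_eq]
  linarith [abs_cellSum_sub_integral_le φ (hM m hm)]

/-- The weight is 2 · 3^{-(m+1)}, because `cellSum` counts each junction point twice; the three
boundary values are negligible in the limit. -/
theorem tendsto_interiorSum (φ : C(gasket q, ℝ)) :
    Tendsto (fun m : ℕ => 2 / 3 * (1 / 3 : ℝ) ^ m * interiorSum q m φ) atTop
      (𝓝 (∫ x, φ x ∂gasketMeasure q)) := by
  have h0 : Tendsto (fun m : ℕ => (1 / 3 : ℝ) ^ m * (1 / 3 * ∑ i, φ (vertex q i))) atTop (𝓝 0) := by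
    simpa using (tendsto_pow_atTop_nhds_zero_of_lt_one (by norm_num : (0 : ℝ) ≤ 1 / 3)
      (by norm_num)).mul_const (1 / 3 * ∑ i, φ (vertex q i))
  have h := (tendsto_cellSum φ).sub h0
  rw [sub_zero] at h
  refine h.congr fun m => ?_
  rw [cellSum_eq, pow_succ]
  ring

/-! ### Green's formula -/

/-- Summation by parts: where two cells meet, their corner differences add up to minus the graph
Laplacian. -/
theorem energySum_eq (hq : IsEquilateral q) (m : ℕ) (u v : gasket q → ℝ) :
    energySum q m u v = ∑ i, u (vertex q i) * cornerDiff q m i v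
      - interiorSum q m (fun x => u x * graphLaplacian q m v x) := by
  induction m generalizing u v with
  | zero => simp [energySum, interiorSum]
  | succ m ih =>
    have h1 : ∀ e, interiorSum q m ((fun x => u x * graphLaplacian q (m + 1) v x) ∘ F q e)
        = interiorSum q m fun x => (u ∘ F q e) x * graphLaplacian q m (v ∘ F q e) x := fun e =>
      interiorSum_congr hq fun x hx => by
        simp only [Function.comp_apply, graphLaplacian_F hq v e hx.2]
    simp only [energySum, interiorSum, ih, Finset.sum_sub_distrib, h1]
    rw [sum_pairs fun a b => (u ∘ F q a) (vertex q b) * cornerDiff q m b (v ∘ F q a)]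
    simp only [Function.comp_apply, F_vertex_self, cornerDiff_F_self]
    have h2 : ∀ e : Fin 3, u (F q e (vertex q (e + 1))) * cornerDiff q m (e + 1) (v ∘ F q e)
        + u (F q (e + 1) (vertex q e)) * cornerDiff q m e (v ∘ F q (e + 1))
        = -(u (F q e (vertex q (e + 1)))
          * graphLaplacian q (m + 1) v (F q e (vertex q (e + 1)))) := fun e => by
      rw [graphLaplacian_junction hq m v (fin_three_ne e).1, F_vertex_comm (e + 1) e]
      ring
    simp only [h2, Finset.sum_neg_distrib]
    simp only [Function.comp_def]
    ring

/-- Since (5/3)^m = (2/3) 3^{-m} · (3/2) 5^m, the interior term is a Riemann sum of u times the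
renormalized Laplacian of v, which may be replaced by g because the convergence is uniform. -/
theorem tendsto_energySum (hq : IsEquilateral q) (u : C(gasket q, ℝ)) {v g : C(gasket q, ℝ)}
    (hv : HasLaplacian q v g) :
    Tendsto (fun m : ℕ => (5 / 3 : ℝ) ^ m * energySum q m u v) atTop
      (𝓝 (∑ i, u (vertex q i) * normalDeriv q v i - ip q u g)) := by
  have h1 : Tendsto (fun m : ℕ => ∑ i, u (vertex q i) * ((5 / 3 : ℝ) ^ m * cornerDiff q m i v))
      atTop (𝓝 (∑ i, u (vertex q i) * normalDeriv q v i)) :=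
    tendsto_finsetSum _ fun i _ =>
      (hasNormalDeriv_iff.1 (hv.hasNormalDeriv hq i)).const_mul _
  have h2 : Tendsto (fun m : ℕ => 2 / 3 * (1 / 3 : ℝ) ^ m * interiorSum q m (u * g)) atTop
      (𝓝 (ip q u g)) := tendsto_interiorSum (u * g)
  have h3 : Tendsto (fun m : ℕ => (5 / 3 : ℝ) ^ m
      * interiorSum q m (fun x => u x * graphLaplacian q m v x)
      - 2 / 3 * (1 / 3 : ℝ) ^ m * interiorSum q m (u * g)) atTop (𝓝 0) := by
    rw [Metric.tendsto_atTop]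
    intro ε hε
    have hK : 0 < ‖u‖ + 1 := by positivity
    obtain ⟨M, hM⟩ := hv (ε / (‖u‖ + 1)) (by positivity)
    refine ⟨M, fun m hm => ?_⟩
    rw [dist_zero_right, Real.norm_eq_abs]
    have hb : ∀ x ∈ V q m \ V q 0,
        |3 / 2 * 5 ^ m * (u x * graphLaplacian q m v x) + -1 * (⇑u * ⇑g) x|
          ≤ ‖u‖ * (ε / (‖u‖ + 1)) := fun x hx => by
      have e : 3 / 2 * 5 ^ m * (u x * graphLaplacian q m v x) + -1 * (⇑u * ⇑g) x
        = u x * (3 / 2 * 5 ^ m * graphLaplacian q m v x - g x) := by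
        rw [Pi.mul_apply]; ring
      rw [e, abs_mul]
      exact mul_le_mul (u.norm_coe_le_norm x) (hM m hm x hx).le (abs_nonneg _) (norm_nonneg _)
    have h4 := abs_interiorSum_le hq hb
    rw [interiorSum_lin] at h4
    have h35 : (5 / 3 : ℝ) ^ m = 5 ^ m * (1 / 3) ^ m := by rw [← mul_pow]; norm_num
    have h33 : (1 / 3 : ℝ) ^ m * 3 ^ m = 1 := by rw [← mul_pow]; norm_num
    have hp : (0 : ℝ) < (1 / 3) ^ m := by positivity
    calc _ = 2 / 3 * (1 / 3) ^ m * |3 / 2 * 5 ^ m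
            * interiorSum q m (fun x => u x * graphLaplacian q m v x)
            + -1 * interiorSum q m (⇑u * ⇑g)| := by
          rw [← abs_of_pos (by positivity : (0 : ℝ) < 2 / 3 * (1 / 3) ^ m), ← abs_mul,
            abs_of_pos (by positivity : (0 : ℝ) < 2 / 3 * (1 / 3) ^ m), h35]
          congr 1
          ring
      _ ≤ 2 / 3 * (1 / 3) ^ m * (3 / 2 * (3 ^ m - 1) * (‖u‖ * (ε / (‖u‖ + 1)))) := by gcongr
      _ = (1 - (1 / 3) ^ m) * (‖u‖ * (ε / (‖u‖ + 1))) := by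
          linear_combination (‖u‖ * (ε / (‖u‖ + 1))) * h33
      _ ≤ 1 * (‖u‖ * (ε / (‖u‖ + 1))) := by gcongr; linarith
      _ < (‖u‖ + 1) * (ε / (‖u‖ + 1)) := by
          rw [one_mul]
          exact mul_lt_mul_of_pos_right (by linarith) (by positivity)
      _ = ε := by field_simp
  have h := (h1.sub h3).sub h2
  rw [sub_zero] at h
  refine h.congr fun m => ?_
  rw [energySum_eq hq, mul_sub, Finset.mul_sum]
  have : ∀ i, u (vertex q i) * ((5 / 3 : ℝ) ^ m * cornerDiff q m i v)
    = (5 / 3 : ℝ) ^ m * (u (vertex q i) * cornerDiff q m i v) := fun i => by ring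
  simp only [this]
  ring

theorem ip_comm (u v : C(gasket q, ℝ)) : ip q u v = ip q v u := by
  simp only [ip, mul_comm]

/-- Green's formula. -/
theorem green (hq : IsEquilateral q) {u f v g : C(gasket q, ℝ)} (hu : HasLaplacian q u f)
    (hv : HasLaplacian q v g) : ip q u g - ip q f v
      = ∑ i, (u (vertex q i) * normalDeriv q v i - v (vertex q i) * normalDeriv q u i) := by
  have h1 := tendsto_energySum hq u hv
  have h2 := tendsto_energySum hq v hu
  -- The energy is symmetric, so the two sequences coincide and their limits agree.
  simp only [energySum_comm _ (⇑u) (⇑v)] at h1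
  have h := tendsto_nhds_unique h1 h2
  rw [ip_comm v f] at h
  rw [Finset.sum_sub_distrib]
  linarith

/-! ### Symmetries of the gasket -/

/-- The functions (L_i - c_i) / D_i are barycentric coordinates, so the permutation of the vertices
extends to an affine map. The weights of an address add up to 1, hence this map acts digit by digit.
-/
theorem exists_symmetry (hq : IsEquilateral q) (σ : Equiv.Perm (Fin 3)) :
    ∃ T : C(gasket q, gasket q), ∀ a, T (point q a) = point q (σ ∘ a) := by
  choose L c D hD hi hj using exists_functional q hq
  set A : Plane →L[ℝ] Plane := ∑ i, (D i)⁻¹ • (L i).smulRight (q (σ i)) with hA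
  set t : Plane := ∑ i, (-(c i / D i)) • q (σ i) with ht
  have hvert : ∀ j, A (q j) + t = q (σ j) := by
    intro j
    have h : ∀ i, ((D i)⁻¹ • (L i).smulRight (q (σ i))) (q j) + (-(c i / D i)) • q (σ i)
        = if i = j then q (σ i) else 0 := by
      intro i
      have hDi := (hD i).ne'
      rw [smul_apply, ContinuousLinearMap.smulRight_apply, smul_smul,
        ← add_smul]
      split_ifs with hij
      · subst hij
        rw [hi]
        convert one_smul ℝ (q (σ i)) using 2
        field_simp
        ring
      · rw [hj i j (Ne.symm hij)]
        convert zero_smul ℝ (q (σ i)) using 2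
        field_simp
        ring
    rw [hA, ht, sum_apply, ← Finset.sum_add_distrib]
    simp only [h, Finset.sum_ite_eq', Finset.mem_univ, if_true]
  have haddr : ∀ a, A (address q a) + t = address q (σ ∘ a) := by
    intro a
    have h1 := (A.hasSum (summable_term q a).hasSum).add (hasSum_half.smul_const t)
    rw [one_smul] at h1
    refine (h1.tsum_eq.symm.trans ?_)
    refine tsum_congr fun k => ?_
    rw [map_smul, ← smul_add, hvert]
    rfl
  have hmem : ∀ x : gasket q, A x + t ∈ gasket q := fun x => by
    obtain ⟨a, rfl⟩ := exists_point x
    exact ⟨σ ∘ a, (haddr a).symm⟩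
  exact ⟨⟨fun x => ⟨A x + t, hmem x⟩, by fun_prop⟩, fun a => Subtype.ext (haddr a)⟩

/-- The symmetry of the gasket that permutes the boundary points by `σ`. -/
def symmetry (hq : IsEquilateral q) (σ : Equiv.Perm (Fin 3)) : C(gasket q, gasket q) :=
  (exists_symmetry hq σ).choose

theorem symmetry_point (hq : IsEquilateral q) (σ : Equiv.Perm (Fin 3)) (a : ℕ → Fin 3) :
    symmetry hq σ (point q a) = point q (σ ∘ a) :=
  (exists_symmetry hq σ).choose_spec a

theorem symmetry_vertex (hq : IsEquilateral q) (σ : Equiv.Perm (Fin 3)) (i : Fin 3) :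
    symmetry hq σ (vertex q i) = vertex q (σ i) := by
  rw [vertex_eq_point, symmetry_point, vertex_eq_point]
  rfl

theorem symmetry_F (hq : IsEquilateral q) (σ : Equiv.Perm (Fin 3)) (i : Fin 3) (x : gasket q) :
    symmetry hq σ (F q i x) = F q (σ i) (symmetry hq σ x) := by
  obtain ⟨a, rfl⟩ := exists_point x
  rw [F_point, symmetry_point, symmetry_point, F_point]
  congr 1
  funext k
  cases k <;> rfl

theorem symmetry_iterate (hq : IsEquilateral q) (σ : Equiv.Perm (Fin 3)) (i : Fin 3) (n : ℕ)
    (x : gasket q) : symmetry hq σ ((F q i)^[n] x) = (F q (σ i))^[n] (symmetry hq σ x) := by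
  induction n with
  | zero => rfl
  | succ n ih => rw [Function.iterate_succ_apply', symmetry_F, ih, Function.iterate_succ_apply']

theorem cornerDiff_symmetry (hq : IsEquilateral q) (σ : Equiv.Perm (Fin 3)) (n : ℕ) (i : Fin 3)
    (u : gasket q → ℝ) :
    cornerDiff q n i (u ∘ symmetry hq σ) = cornerDiff q n (σ i) u := by
  simp only [cornerDiff, Function.comp_apply, symmetry_vertex, symmetry_iterate]
  exact Equiv.sum_comp σ fun j => u (vertex q (σ i)) - u ((F q (σ i))^[n] (vertex q j))

theorem comp_symmetry_F (hq : IsEquilateral q) (σ : Equiv.Perm (Fin 3)) (u : gasket q → ℝ)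
    (e : Fin 3) : (u ∘ symmetry hq σ) ∘ F q e = (u ∘ F q (σ e)) ∘ symmetry hq σ := by
  funext x
  simp only [Function.comp_apply, symmetry_F]

theorem symmetry_mem_interior (hq : IsEquilateral q) (σ : Equiv.Perm (Fin 3)) {m : ℕ} :
    ∀ x ∈ V q m \ V q 0, symmetry hq σ x ∈ V q m \ V q 0 := by
  induction m with
  | zero => simp
  | succ m ih =>
    intro x hx
    rcases interior_cases hx with ⟨e, y, hy, rfl⟩ | ⟨a, b, hab, rfl⟩
    · rw [symmetry_F]
      exact F_mem_interior hq _ (ih y hy)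
    · rw [symmetry_F, symmetry_vertex]
      exact F_vertex_mem_interior hq (σ.injective.ne hab) m

theorem graphLaplacian_symmetry (hq : IsEquilateral q) (σ : Equiv.Perm (Fin 3)) {m : ℕ}
    (u : gasket q → ℝ) : ∀ x ∈ V q m \ V q 0,
      graphLaplacian q m (u ∘ symmetry hq σ) x = graphLaplacian q m u (symmetry hq σ x) := by
  induction m generalizing u with
  | zero => simp
  | succ m ih =>
    intro x hx
    rcases interior_cases hx with ⟨e, y, hy, rfl⟩ | ⟨a, b, hab, rfl⟩
    · rw [graphLaplacian_F hq _ e hy.2, comp_symmetry_F, ih _ y hy, symmetry_F,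
        graphLaplacian_F hq _ _ (symmetry_mem_interior hq σ y hy).2]
    · rw [symmetry_F, symmetry_vertex, graphLaplacian_junction hq _ _ hab,
        graphLaplacian_junction hq _ _ (σ.injective.ne hab), comp_symmetry_F, comp_symmetry_F,
        cornerDiff_symmetry, cornerDiff_symmetry]

theorem HasLaplacian.comp_symmetry (hq : IsEquilateral q) {u f : C(gasket q, ℝ)}
    (hu : HasLaplacian q u f) (σ : Equiv.Perm (Fin 3)) :
    HasLaplacian q (u.comp (symmetry hq σ)) (f.comp (symmetry hq σ)) := by
  intro ε hε
  obtain ⟨M, hM⟩ := hu ε hε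
  refine ⟨M, fun m hm x hx => ?_⟩
  have h := hM m hm _ (symmetry_mem_interior hq σ x hx)
  rwa [← graphLaplacian_symmetry hq σ u x hx] at h

theorem cellSum_symmetry (hq : IsEquilateral q) (σ : Equiv.Perm (Fin 3)) (m : ℕ)
    (φ : gasket q → ℝ) : cellSum q m (φ ∘ symmetry hq σ) = cellSum q m φ := by
  induction m generalizing φ with
  | zero =>
    simp only [cellSum, Function.comp_apply, symmetry_vertex]
    exact Equiv.sum_comp σ fun i => φ (vertex q i)
  | succ m ih =>
    simp only [cellSum, comp_symmetry_F, ih]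
    exact Equiv.sum_comp σ fun e => cellSum q m (φ ∘ F q e)

theorem ip_comp_symmetry (hq : IsEquilateral q) (σ : Equiv.Perm (Fin 3)) (u v : C(gasket q, ℝ)) :
    ip q (u.comp (symmetry hq σ)) (v.comp (symmetry hq σ)) = ip q u v := by
  have h1 := tendsto_cellSum ((u * v).comp (symmetry hq σ))
  have h2 := tendsto_cellSum (u * v)
  simp only [ContinuousMap.coe_comp, cellSum_symmetry] at h1
  exact tendsto_nhds_unique h1 h2

theorem HasNormalDeriv.comp_symmetry (hq : IsEquilateral q) {u : gasket q → ℝ} {i : Fin 3} {d : ℝ}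
    (σ : Equiv.Perm (Fin 3)) (hu : HasNormalDeriv q u (σ i) d) :
    HasNormalDeriv q (u ∘ symmetry hq σ) i d := by
  rw [hasNormalDeriv_iff] at *
  simpa only [cornerDiff_symmetry] using hu

theorem normalDeriv_comp_symmetry (hq : IsEquilateral q) (u : C(gasket q, ℝ)) (i : Fin 3)
    (σ : Equiv.Perm (Fin 3)) :
    normalDeriv q (u.comp (symmetry hq σ)) i = normalDeriv q u (σ i) := by
  simp only [normalDeriv, ContinuousMap.coe_comp, cornerDiff_symmetry]

theorem HasTangentialDeriv.comp_rotation (hq : IsEquilateral q) {u : gasket q → ℝ} {i : Fin 3}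
    {d : ℝ} (σ : Equiv.Perm (Fin 3)) (h1 : σ (i + 1) = σ i + 1) (h2 : σ (i - 1) = σ i - 1)
    (hu : HasTangentialDeriv q u (σ i) d) : HasTangentialDeriv q (u ∘ symmetry hq σ) i d := by
  simpa only [HasTangentialDeriv, Function.comp_apply, symmetry_iterate, symmetry_vertex, h1, h2]
    using hu

theorem HasTangentialDeriv.comp_reflection (hq : IsEquilateral q) {u : gasket q → ℝ} {i : Fin 3}
    {d : ℝ} (σ : Equiv.Perm (Fin 3)) (h1 : σ (i + 1) = σ i - 1) (h2 : σ (i - 1) = σ i + 1)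
    (hu : HasTangentialDeriv q u (σ i) d) : HasTangentialDeriv q (u ∘ symmetry hq σ) i (-d) := by
  simp only [HasTangentialDeriv, Function.comp_apply, symmetry_iterate, symmetry_vertex, h1, h2]
  refine hu.neg.congr fun m => ?_
  ring

/-! ### Towers -/

/-- The sequence `0, u₀, u₁, …`. -/
def below (u : ℕ → C(gasket q, ℝ)) : ℕ → C(gasket q, ℝ)
  | 0 => 0
  | j + 1 => u j

/-- A sequence with `Δ u₀ = 0` and `Δ u_{j+1} = u_j`; formally, `∑ zʲ u_j` is an eigenfunction of
the Laplacian with eigenvalue `z`. -/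
def IsTower (q : Fin 3 → Plane) (u : ℕ → C(gasket q, ℝ)) : Prop :=
  ∀ j, HasLaplacian q (u j) (below u j)

/-- The generating function of the values at `qᵢ`. -/
def valSeries (u : ℕ → C(gasket q, ℝ)) (i : Fin 3) : PowerSeries ℝ :=
  PowerSeries.mk fun j => u j (vertex q i)

/-- The generating function of the normal derivatives at `qᵢ`. -/
def normalSeries (u : ℕ → C(gasket q, ℝ)) (i : Fin 3) : PowerSeries ℝ :=
  PowerSeries.mk fun j => normalDeriv q (u j) i

theorem IsTower.comp_symmetry (hq : IsEquilateral q) {u : ℕ → C(gasket q, ℝ)} (hu : IsTower q u)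
    (σ : Equiv.Perm (Fin 3)) : IsTower q fun j => (u j).comp (symmetry hq σ) := fun j => by
  have := (hu j).comp_symmetry hq σ
  cases j <;> exact this

theorem IsTower.smul (hq : IsEquilateral q) {u : ℕ → C(gasket q, ℝ)} (hu : IsTower q u) (c : ℝ) :
    IsTower q fun j => c • u j := fun j => by
  have := (hu j).smul hq c
  cases j
  · simpa [below] using this
  · exact this

theorem IsTower.add (hq : IsEquilateral q) {u v : ℕ → C(gasket q, ℝ)} (hu : IsTower q u)
    (hv : IsTower q v) : IsTower q fun j => u j + v j := fun j => by
  have := (hu j).add hq (hv j)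
  cases j
  · simpa [below] using this
  · exact this

/-- The powers of 5 compensate the factor 1/5 that the Laplacian acquires under a contraction; in
generating functions they replace z by 5z. -/
theorem IsTower.comp_F (hq : IsEquilateral q) {u : ℕ → C(gasket q, ℝ)} (hu : IsTower q u)
    (e : Fin 3) : IsTower q fun j => (5 : ℝ) ^ j • (u j).comp (contF q e) := fun j => by
  have := ((hu j).comp_F hq e).smul hq (5 ^ j)
  cases j with
  | zero => simpa [below] using this
  | succ j =>
    rw [smul_smul, pow_succ, mul_assoc, show (5 * (1 / 5) : ℝ) = 1 by norm_num, mul_one,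
      ← pow_succ] at this
    exact this

theorem IsTower.eq_zero (hq : IsEquilateral q) {u : ℕ → C(gasket q, ℝ)} (hu : IsTower q u)
    (h : ∀ i j, u j (vertex q i) = 0) (j : ℕ) : u j = 0 := by
  induction j with
  | zero => exact eq_zero_of_harmonic hq (hu 0) fun i => h i 0
  | succ j ih =>
    have := hu (j + 1)
    rw [below, ih] at this
    exact eq_zero_of_harmonic hq this fun i => h i (j + 1)

theorem ip_zero_left (u : C(gasket q, ℝ)) : ip q 0 u = 0 := by simp [ip]

theorem ip_zero_right (u : C(gasket q, ℝ)) : ip q u 0 = 0 := by simp [ip]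

theorem ip_neg_right (u v : C(gasket q, ℝ)) : ip q u (-v) = -ip q u v := by
  simp [ip, integral_neg]

theorem ip_neg_left (u v : C(gasket q, ℝ)) : ip q (-u) v = -ip q u v := by
  simp [ip, integral_neg]

theorem ip_add_right (u v w : C(gasket q, ℝ)) : ip q u (v + w) = ip q u v + ip q u w := by
  simp only [ip, ContinuousMap.add_apply, mul_add]
  exact integral_add (integrable_continuousMap (u * v)) (integrable_continuousMap (u * w))

/-- Both sides equal the sum of the products ⟨u_a, v_b⟩ over a + b = n - 1. -/
theorem sum_ip_below (u v : ℕ → C(gasket q, ℝ)) (n : ℕ) :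
    ∑ p ∈ Finset.HasAntidiagonal.antidiagonal n, ip q (u p.1) (below v p.2)
      = ∑ p ∈ Finset.HasAntidiagonal.antidiagonal n, ip q (below u p.1) (v p.2) := by
  cases n with
  | zero => simp [below, ip_zero_left, ip_zero_right]
  | succ n =>
    rw [Finset.Nat.sum_antidiagonal_succ', Finset.Nat.sum_antidiagonal_succ]
    simp only [below, ip_zero_left, ip_zero_right]

/-- The two formal eigenfunctions share the eigenvalue z, so the interior terms of Green's formula
cancel in every coefficient. -/
theorem green_tower (hq : IsEquilateral q) {u v : ℕ → C(gasket q, ℝ)} (hu : IsTower q u)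
    (hv : IsTower q v) :
    ∑ i, (valSeries u i * normalSeries v i - valSeries v i * normalSeries u i) = 0 := by
  ext n
  have h : ∀ i, PowerSeries.coeff n (valSeries u i * normalSeries v i
      - valSeries v i * normalSeries u i) = ∑ p ∈ Finset.HasAntidiagonal.antidiagonal n,
        (u p.1 (vertex q i) * normalDeriv q (v p.2) i
          - v p.2 (vertex q i) * normalDeriv q (u p.1) i) := fun i => by
    rw [mul_comm (valSeries v i), map_sub, PowerSeries.coeff_mul, PowerSeries.coeff_mul,
      ← Finset.sum_sub_distrib]
    simp only [valSeries, normalSeries, PowerSeries.coeff_mk]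
    exact Finset.sum_congr rfl fun p _ => by ring
  rw [map_sum, Finset.sum_congr rfl fun i _ => h i, Finset.sum_comm, map_zero]
  rw [← Finset.sum_congr rfl fun p _ => green hq (hu p.1) (hv p.2), Finset.sum_sub_distrib,
    sum_ip_below, sub_self]

/-- Each use of Green's formula lowers j and raises k by one; the process ends because the lowest
member of a tower is harmonic. -/
theorem ip_tower (hq : IsEquilateral q) {u v : ℕ → C(gasket q, ℝ)} (hu : IsTower q u)
    (hv : IsTower q v) (j k : ℕ) : ip q (u j) (v k) = ∑ l ∈ Finset.range (j + 1),
      ∑ i, (u (j - l) (vertex q i) * normalDeriv q (v (k + l + 1)) i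
        - v (k + l + 1) (vertex q i) * normalDeriv q (u (j - l)) i) := by
  induction j generalizing k with
  | zero =>
    have h := green hq (hu 0) (hv (k + 1))
    simp only [below, ip_zero_left, sub_zero] at h
    simpa using h
  | succ j ih =>
    have h := green hq (hu (j + 1)) (hv (k + 1))
    simp only [below] at h
    rw [Finset.sum_range_succ', sub_eq_iff_eq_add'.1 h, ih (k + 1)]
    congr 1
    refine Finset.sum_congr rfl fun l _ => ?_
    rw [Nat.add_sub_add_right, show k + 1 + l + 1 = k + (l + 1) + 1 by ring]

/-! ### Towers of monomials -/

/-- The sequence `P_{0i}, P_{1i}, …` of monomials at `qₙ`. -/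
structure IsMonomialTower (q : Fin 3 → Plane) (n : Fin 3) (i : ℕ) (p : ℕ → C(gasket q, ℝ)) :
    Prop where
  tower : IsTower q p
  val : ∀ j, p j (vertex q n) = if j = 0 ∧ i = 1 then 1 else 0
  normal : ∀ j, HasNormalDeriv q (p j) n (if j = 0 ∧ i = 2 then 1 else 0)
  tangential : ∀ j, HasTangentialDeriv q (p j) n (if j = 0 ∧ i = 3 then 1 else 0)

theorem eq_of_laplacian_of_jet (hq : IsEquilateral q) {u v f : C(gasket q, ℝ)} {n : Fin 3}
    {a b c : ℝ} (hu : HasLaplacian q u f) (hv : HasLaplacian q v f)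
    (hu0 : u (vertex q n) = a) (hv0 : v (vertex q n) = a)
    (hu1 : HasNormalDeriv q u n b) (hv1 : HasNormalDeriv q v n b)
    (hu2 : HasTangentialDeriv q u n c) (hv2 : HasTangentialDeriv q v n c) : u = v := by
  have h := hu.sub hq hv
  rw [sub_self] at h
  have hsub : (⇑(u - v) : gasket q → ℝ) = fun y => 1 * u y + -1 * v y := by
    funext y
    rw [ContinuousMap.sub_apply]
    ring
  refine sub_eq_zero.1 (eq_zero_of_harmonic_of_jet hq h (n := n) ?_ ?_ ?_)
  · rw [ContinuousMap.sub_apply, hu0, hv0, sub_self]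
  · have := normalDeriv_lin hu1 hv1 1 (-1)
    rw [hsub]
    convert this using 1
    ring
  · have := hu2.lin hv2 1 (-1)
    rw [hsub]
    convert this using 1
    ring

theorem IsMonomialTower.unique (hq : IsEquilateral q) {n : Fin 3} {i : ℕ}
    {p p' : ℕ → C(gasket q, ℝ)} (h : IsMonomialTower q n i p) (h' : IsMonomialTower q n i p') :
    p = p' := by
  funext j
  induction j with
  | zero =>
    exact eq_of_laplacian_of_jet hq (h.tower 0) (h'.tower 0) (h.val _) (h'.val _)
      (h.normal _) (h'.normal _) (h.tangential _) (h'.tangential _)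
  | succ j ih =>
    have h1 := h.tower (j + 1)
    rw [below, ih] at h1
    exact eq_of_laplacian_of_jet hq h1 (h'.tower (j + 1)) (h.val _) (h'.val _)
      (h.normal _) (h'.normal _) (h.tangential _) (h'.tangential _)

/-- By induction the Laplacians of the two functions agree, so their difference is harmonic with
zero jet. -/
theorem isMonomial_unique (hq : IsEquilateral q) {n : Fin 3} {j i : ℕ} {P P' : C(gasket q, ℝ)}
    (h : IsMonomial q n j i P) (h' : IsMonomial q n j i P') : P = P' := by
  induction j generalizing P P' with
  | zero =>
    obtain ⟨u, rfl, hu, hu0, hj⟩ := h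
    obtain ⟨v, rfl, hv, hv0, hj'⟩ := h'
    have h1 := hu 0 le_rfl
    have h2 := hv 0 le_rfl
    rw [hu0] at h1
    rw [hv0] at h2
    obtain ⟨a1, a2, a3⟩ := hj 0 le_rfl
    obtain ⟨b1, b2, b3⟩ := hj' 0 le_rfl
    exact eq_of_laplacian_of_jet hq h1 h2 a1 b1 a2 b2 a3 b3
  | succ j ih =>
    obtain ⟨u, rfl, hu, hu0, hj⟩ := h
    obtain ⟨v, rfl, hv, hv0, hj'⟩ := h'
    have h1 := hu 0 (Nat.zero_le _)
    have h2 := hv 0 (Nat.zero_le _)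
    have huv : u 1 = v 1 := ih
      ⟨fun m => u (m + 1), rfl, fun m hm => hu (m + 1) (by omega), hu0, fun m hm => by
        simpa only [add_left_inj] using hj (m + 1) (by omega)⟩
      ⟨fun m => v (m + 1), rfl, fun m hm => hv (m + 1) (by omega), hv0, fun m hm => by
        simpa only [add_left_inj] using hj' (m + 1) (by omega)⟩
    rw [zero_add, huv] at h1
    obtain ⟨a1, a2, a3⟩ := hj 0 (Nat.zero_le _)
    obtain ⟨b1, b2, b3⟩ := hj' 0 (Nat.zero_le _)
    exact eq_of_laplacian_of_jet hq h1 h2 a1 b1 a2 b2 a3 b3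

/-- `IsMonomial` provides an unrelated sequence of Laplacians for each j; uniqueness identifies the
Laplacian of P_{j+1} with P_j. -/
theorem isMonomialTower (hq : IsEquilateral q) {n : Fin 3} {i : ℕ} {P : ℕ → C(gasket q, ℝ)}
    (h : ∀ j, IsMonomial q n j i (P j)) : IsMonomialTower q n i P := by
  have hjet : ∀ j, P j (vertex q n) = (if j = 0 ∧ i = 1 then 1 else 0) ∧
      HasNormalDeriv q (P j) n (if j = 0 ∧ i = 2 then 1 else 0) ∧
      HasTangentialDeriv q (P j) n (if j = 0 ∧ i = 3 then 1 else 0) := fun j => by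
    obtain ⟨u, hu, -, -, hj⟩ := h j
    simpa only [hu, eq_comm (a := 0) (b := j)] using hj 0 (Nat.zero_le _)
  refine ⟨fun j => ?_, fun j => (hjet j).1, fun j => (hjet j).2.1, fun j => (hjet j).2.2⟩
  cases j with
  | zero =>
    obtain ⟨u, hu, hl, h0, -⟩ := h 0
    have := hl 0 le_rfl
    rwa [h0, hu] at this
  | succ j =>
    obtain ⟨u, hu, hl, h0, hj⟩ := h (j + 1)
    have h1 := hl 0 (Nat.zero_le _)
    have : u 1 = P j := isMonomial_unique hq
      ⟨fun m => u (m + 1), rfl, fun m hm => hl (m + 1) (by omega), h0, fun m hm => by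
        simpa only [add_left_inj] using hj (m + 1) (by omega)⟩ (h j)
    rwa [zero_add, this, hu] at h1

theorem IsMonomialTower.comp_rotation (hq : IsEquilateral q) {n : Fin 3} {i : ℕ}
    {p : ℕ → C(gasket q, ℝ)} (σ : Equiv.Perm (Fin 3)) (h1 : σ (n + 1) = σ n + 1)
    (h2 : σ (n - 1) = σ n - 1) (h : IsMonomialTower q (σ n) i p) :
    IsMonomialTower q n i fun j => (p j).comp (symmetry hq σ) where
  tower := h.tower.comp_symmetry hq σ
  val j := by rw [ContinuousMap.comp_apply, symmetry_vertex, h.val]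
  normal j := (h.normal j).comp_symmetry hq σ
  tangential j := (h.tangential j).comp_rotation hq σ h1 h2

theorem IsMonomialTower.comp_reflection (hq : IsEquilateral q) {n : Fin 3} {i : ℕ} (hi : i ≠ 3)
    {p : ℕ → C(gasket q, ℝ)} (σ : Equiv.Perm (Fin 3)) (h1 : σ (n + 1) = σ n - 1)
    (h2 : σ (n - 1) = σ n + 1) (h : IsMonomialTower q (σ n) i p) :
    IsMonomialTower q n i fun j => (p j).comp (symmetry hq σ) where
  tower := h.tower.comp_symmetry hq σ
  val j := by rw [ContinuousMap.comp_apply, symmetry_vertex, h.val]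
  normal j := (h.normal j).comp_symmetry hq σ
  tangential j := by
    have := (h.tangential j).comp_reflection hq σ h1 h2
    simpa [hi] using this

theorem IsMonomialTower.neg_comp_reflection (hq : IsEquilateral q) {n : Fin 3}
    {p : ℕ → C(gasket q, ℝ)} (σ : Equiv.Perm (Fin 3)) (h1 : σ (n + 1) = σ n - 1)
    (h2 : σ (n - 1) = σ n + 1) (h : IsMonomialTower q (σ n) 3 p) :
    IsMonomialTower q n 3 fun j => (-1 : ℝ) • (p j).comp (symmetry hq σ) where
  tower := (h.tower.comp_symmetry hq σ).smul hq _
  val j := by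
    rw [ContinuousMap.smul_apply, ContinuousMap.comp_apply, symmetry_vertex, h.val]
    simp
  normal j := by
    have h0 := (h.normal j).comp_symmetry hq σ
    have := normalDeriv_lin h0 h0 (-1) 0
    convert this using 1
    · funext y
      simp
    · simp
  tangential j := by
    have h0 := (h.tangential j).comp_reflection hq σ h1 h2
    have := h0.lin h0 (-1) 0
    convert this using 1
    · funext y
      simp
    · ring

/-- Together with uniqueness this makes the tower invariant under dilation about its base point. The
constant c restores the nonzero datum: a value is unchanged, a tangential derivative is divided by
5. -/
theorem IsMonomialTower.comp_F (hq : IsEquilateral q) {n : Fin 3} {i : ℕ} {c : ℝ}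
    (hc : (i = 1 ∧ c = 1) ∨ (i = 3 ∧ c = 5)) {p : ℕ → C(gasket q, ℝ)}
    (h : IsMonomialTower q n i p) :
    IsMonomialTower q n i fun j => c • (5 : ℝ) ^ j • (p j).comp (contF q n) where
  tower := (h.tower.comp_F hq n).smul hq c
  val j := by
    have h0 : (p j).comp (contF q n) (vertex q n) = p j (vertex q n) :=
      congrArg (p j) (F_vertex_self n)
    rw [ContinuousMap.smul_apply, ContinuousMap.smul_apply, h0, h.val]
    rcases hc with ⟨rfl, rfl⟩ | ⟨rfl, rfl⟩ <;> rcases j with _ | j <;> simp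
  normal j := by
    have h0 := (h.normal j).comp_F
    have := normalDeriv_lin h0 h0 (c * 5 ^ j) 0
    convert this using 1
    · funext y
      simp [contF, mul_assoc]
    · rcases hc with ⟨rfl, rfl⟩ | ⟨rfl, rfl⟩ <;> simp
  tangential j := by
    have h0 := (h.tangential j).comp_F
    have := h0.lin h0 (c * 5 ^ j) 0
    convert this using 1
    · funext y
      simp [contF, mul_assoc]
    · rcases hc with ⟨rfl, rfl⟩ | ⟨rfl, rfl⟩ <;> rcases j with _ | j <;> simp

theorem normalDeriv_smul (hq : IsEquilateral q) {u f : C(gasket q, ℝ)} (hu : HasLaplacian q u f)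
    (c : ℝ) (i : Fin 3) : normalDeriv q (c • u : C(gasket q, ℝ)) i = c * normalDeriv q u i := by
  have h := hu.hasNormalDeriv hq i
  have := (normalDeriv_lin h h c 0).normalDeriv_eq
  simp only [zero_mul, add_zero] at this
  exact this

/-- `p n i` is the tower of the monomials `P_{ji}^{(n)}`, for `i = 1, 2, 3`. -/
structure MonomialFamily (q : Fin 3 → Plane) (p : Fin 3 → ℕ → ℕ → C(gasket q, ℝ)) : Prop where
  mono : ∀ n, ∀ i ∈ Finset.Icc 1 3, IsMonomialTower q n i (p n i)

namespace MonomialFamily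

variable {p : Fin 3 → ℕ → ℕ → C(gasket q, ℝ)}

theorem one (h : MonomialFamily q p) (n : Fin 3) : IsMonomialTower q n 1 (p n 1) :=
  h.mono n 1 (by decide)

theorem two (h : MonomialFamily q p) (n : Fin 3) : IsMonomialTower q n 2 (p n 2) :=
  h.mono n 2 (by decide)

theorem three (h : MonomialFamily q p) (n : Fin 3) : IsMonomialTower q n 3 (p n 3) :=
  h.mono n 3 (by decide)

/-! ### Symmetries of the monomials -/

theorem rotate (hq : IsEquilateral q) (h : MonomialFamily q p) (n m : Fin 3) {i : ℕ}
    (hi : i ∈ Finset.Icc 1 3) (j : ℕ) :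
    (p (n - m) i j).comp (symmetry hq (Equiv.subRight m)) = p n i j := by
  refine congrFun (((h.mono (n - m) i hi).comp_rotation hq (n := n) (Equiv.subRight m)
    ?_ ?_).unique hq (h.mono n i hi)) j <;> simp only [Equiv.subRight_apply] <;> abel

theorem reflect (hq : IsEquilateral q) (h : MonomialFamily q p) {i : ℕ}
    (hi : i ∈ Finset.Icc 1 2) (j : ℕ) :
    (p 0 i j).comp (symmetry hq (Equiv.swap 1 2)) = p 0 i j := by
  rw [Finset.mem_Icc] at hi
  have hm := h.mono 0 i (Finset.mem_Icc.2 ⟨hi.1, by omega⟩)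
  exact congrFun ((IsMonomialTower.comp_reflection hq (by omega) (n := 0) (Equiv.swap 1 2)
    (by decide) (by decide) hm).unique hq hm) j

/-- The reflection reverses orientation, which changes the sign of the tangential derivative, and it
exchanges the base points q_1 and q_2. -/
theorem reflect_three (hq : IsEquilateral q) (h : MonomialFamily q p) (n : Fin 3) (j : ℕ) :
    (p n 3 j).comp (symmetry hq (Equiv.swap 1 2)) = -p (Equiv.swap 1 2 n) 3 j := by
  have := congrFun ((IsMonomialTower.neg_comp_reflection hq (n := Equiv.swap 1 2 n)
    (Equiv.swap 1 2) (by revert n; decide) (by revert n; decide)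
    (by rw [Equiv.swap_apply_self]; exact h.three n)).unique hq (h.three _)) j
  rw [← this]
  simp

theorem reflect_three_zero (hq : IsEquilateral q) (h : MonomialFamily q p) (j : ℕ) :
    (p 0 3 j).comp (symmetry hq (Equiv.swap 1 2)) = -p 0 3 j :=
  h.reflect_three hq 0 j

theorem val_two (hq : IsEquilateral q) (h : MonomialFamily q p) {i : ℕ}
    (hi : i ∈ Finset.Icc 1 2) (j : ℕ) : p 0 i j (vertex q 2) = p 0 i j (vertex q 1) := by
  conv_rhs => rw [← h.reflect hq hi j]
  rw [ContinuousMap.comp_apply, symmetry_vertex]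
  rfl

theorem normal_two (hq : IsEquilateral q) (h : MonomialFamily q p) {i : ℕ}
    (hi : i ∈ Finset.Icc 1 2) (j : ℕ) :
    normalDeriv q (p 0 i j) 2 = normalDeriv q (p 0 i j) 1 := by
  conv_rhs => rw [← h.reflect hq hi j]
  rw [normalDeriv_comp_symmetry]
  rfl

theorem val_three_two (hq : IsEquilateral q) (h : MonomialFamily q p) (j : ℕ) :
    p 0 3 j (vertex q 2) = -p 0 3 j (vertex q 1) := by
  rw [← ContinuousMap.neg_apply, ← h.reflect_three_zero hq j, ContinuousMap.comp_apply,
    symmetry_vertex]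
  rfl

theorem normal_three_two (hq : IsEquilateral q) (h : MonomialFamily q p) (j : ℕ) :
    normalDeriv q (p 0 3 j) 2 = -normalDeriv q (p 0 3 j) 1 := by
  have h1 := normalDeriv_smul hq ((h.three 0).tower j) (-1) 1
  rw [neg_one_smul, ← h.reflect_three_zero hq j, normalDeriv_comp_symmetry, neg_one_mul] at h1
  exact h1

theorem valSeries_rotate (hq : IsEquilateral q) (h : MonomialFamily q p) {i : ℕ}
    (hi : i ∈ Finset.Icc 1 3) (n m : Fin 3) :
    valSeries (p n i) m = valSeries (p 0 i) (m - n) := by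
  ext j
  simp only [valSeries, PowerSeries.coeff_mk]
  rw [← h.rotate hq n n hi j, sub_self, ContinuousMap.comp_apply, symmetry_vertex]
  rfl

theorem normalSeries_rotate (hq : IsEquilateral q) (h : MonomialFamily q p) {i : ℕ}
    (hi : i ∈ Finset.Icc 1 3) (n m : Fin 3) :
    normalSeries (p n i) m = normalSeries (p 0 i) (m - n) := by
  ext j
  simp only [normalSeries, PowerSeries.coeff_mk]
  rw [← h.rotate hq n n hi j, sub_self, normalDeriv_comp_symmetry]
  rfl

theorem valSeries_two (hq : IsEquilateral q) (h : MonomialFamily q p) {i : ℕ}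
    (hi : i ∈ Finset.Icc 1 2) : valSeries (p 0 i) 2 = valSeries (p 0 i) 1 := by
  ext j
  simp only [valSeries, PowerSeries.coeff_mk, h.val_two hq hi]

theorem normalSeries_two (hq : IsEquilateral q) (h : MonomialFamily q p) {i : ℕ}
    (hi : i ∈ Finset.Icc 1 2) : normalSeries (p 0 i) 2 = normalSeries (p 0 i) 1 := by
  ext j
  simp only [normalSeries, PowerSeries.coeff_mk, h.normal_two hq hi]

theorem valSeries_three_two (hq : IsEquilateral q) (h : MonomialFamily q p) :
    valSeries (p 0 3) 2 = -valSeries (p 0 3) 1 := by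
  ext j
  simp only [valSeries, PowerSeries.coeff_mk, map_neg, h.val_three_two hq]

theorem val_zero (h : MonomialFamily q p) {i : ℕ} (hi : i ∈ Finset.Icc 1 3) (j : ℕ) :
    p 0 i j (vertex q 0) = if j = 0 ∧ i = 1 then 1 else 0 := (h.mono 0 i hi).val j

theorem normal_zero (h : MonomialFamily q p) {i : ℕ} (hi : i ∈ Finset.Icc 1 3) (j : ℕ) :
    normalDeriv q (p 0 i j) 0 = if j = 0 ∧ i = 2 then 1 else 0 :=
  ((h.mono 0 i hi).normal j).normalDeriv_eq

theorem valSeries_zero (h : MonomialFamily q p) {i : ℕ} (hi : i ∈ Finset.Icc 1 3) :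
    valSeries (p 0 i) 0 = if i = 1 then 1 else 0 := by
  ext j
  simp only [valSeries, PowerSeries.coeff_mk, h.val_zero hi]
  split_ifs <;> simp_all [PowerSeries.coeff_one]

theorem normalSeries_zero (h : MonomialFamily q p) {i : ℕ} (hi : i ∈ Finset.Icc 1 3) :
    normalSeries (p 0 i) 0 = if i = 2 then 1 else 0 := by
  ext j
  simp only [normalSeries, PowerSeries.coeff_mk, h.normal_zero hi]
  split_ifs <;> simp_all [PowerSeries.coeff_one]

/-! ### Relations between the boundary data of the monomials -/

/-- Green's formula for types 1 and 2 at q_0 gives 1 + 2(ατ - βη) = 0; for type 2 at q_0 and type 1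
at q_1 it gives βη - ατ - α - τ = 0. The products cancel between them. -/
theorem two_mul_normalSeries_two (hq : IsEquilateral q) (h : MonomialFamily q p) :
    2 * normalSeries (p 0 2) 1 = 1 - 2 * valSeries (p 0 1) 1 := by
  have e1 := green_tower hq (h.one 0).tower (h.two 0).tower
  have e2 := green_tower hq (h.two 0).tower (h.one 1).tower
  simp only [Fin.sum_univ_three, h.valSeries_rotate hq (i := 1) (by decide) 1,
    h.normalSeries_rotate hq (i := 1) (by decide) 1] at e1 e2
  rw [show (0 - 1 : Fin 3) = 2 by decide, show (1 - 1 : Fin 3) = 0 by decide,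
    show (2 - 1 : Fin 3) = 1 by decide] at e2
  simp only [h.valSeries_two hq (i := 1) (by decide), h.valSeries_two hq (i := 2) (by decide),
    h.normalSeries_two hq (i := 1) (by decide), h.normalSeries_two hq (i := 2) (by decide),
    h.valSeries_zero (i := 1) (by decide), h.valSeries_zero (i := 2) (by decide),
    h.normalSeries_zero (i := 1) (by decide), h.normalSeries_zero (i := 2) (by decide),
    if_true, OfNat.ofNat_ne_one, OfNat.one_ne_ofNat, if_false] at e1 e2
  linear_combination -e1 - 2 * e2

/-- The Dirichlet-to-Neumann map of a tower. -/
theorem dirichlet_to_neumann (hq : IsEquilateral q) (h : MonomialFamily q p)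
    {w : ℕ → C(gasket q, ℝ)} (hw : IsTower q w) (i : Fin 3) :
    2 * valSeries (p 0 2) 1 * normalSeries w i = valSeries w (i + 1) + valSeries w (i - 1)
      - 2 * valSeries (p 0 1) 1 * valSeries w i := by
  -- Green's formula against the type 2 tower at q_n, which has value 0 and normal derivative 1
  -- there.
  have e : ∀ n : Fin 3, valSeries w n
      + normalSeries (p 0 2) 1 * (valSeries w (n + 1) + valSeries w (n - 1))
      = valSeries (p 0 2) 1 * (normalSeries w (n + 1) + normalSeries w (n - 1)) := by
    intro n
    have e1 := green_tower hq hw (h.two n).tower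
    rw [sum_fin_three_cyclic n] at e1
    simp only [h.valSeries_rotate hq (i := 2) (by decide) n,
      h.normalSeries_rotate hq (i := 2) (by decide) n, sub_self, add_sub_cancel_left] at e1
    rw [(show ∀ n : Fin 3, n - 1 - n = 2 by decide) n] at e1
    simp only [h.valSeries_two hq (i := 2) (by decide), h.normalSeries_two hq (i := 2) (by decide),
      h.valSeries_zero (i := 2) (by decide), h.normalSeries_zero (i := 2) (by decide),
      if_true, OfNat.ofNat_ne_one, if_false] at e1
    linear_combination e1
  obtain ⟨h1, h2, h3, h4, h5⟩ := fin_three_ne i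
  have e0 := e i
  have e1 := e (i + 1)
  have e2 := e (i - 1)
  rw [h4, add_sub_cancel_right] at e1
  rw [h5, sub_add_cancel] at e2
  -- In this combination only the normal derivative at q_i survives, and 2τ = 1 - 2α eliminates τ.
  linear_combination e0 - e1 - e2 + valSeries w i * h.two_mul_normalSeries_two hq

/-- Adding the Dirichlet-to-Neumann identities of the two cells cancels the normal derivatives by
the matching condition and leaves an equation between values at the junction point and its four
neighbours. -/
theorem junction (hq : IsEquilateral q) (h : MonomialFamily q p)
    {u : ℕ → C(gasket q, ℝ)} (hu : IsTower q u) {a b : Fin 3} (hab : a ≠ b)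
    {w : Fin 3 → ℕ → C(gasket q, ℝ)}
    (hw : ∀ e, w e = fun j => (5 : ℝ) ^ j • (u j).comp (contF q e)) :
    valSeries (w a) b = valSeries (w b) a ∧
    valSeries (w a) (b + 1) + valSeries (w a) (b - 1)
      + valSeries (w b) (a + 1) + valSeries (w b) (a - 1)
      = 4 * valSeries (p 0 1) 1 * valSeries (w a) b := by
  have ht : ∀ e, IsTower q (w e) := fun e => hw e ▸ hu.comp_F hq e
  have h0 : valSeries (w a) b = valSeries (w b) a := by
    ext j
    simp only [valSeries, PowerSeries.coeff_mk, hw, ContinuousMap.smul_apply]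
    congr 1
    exact congrArg (u j) (F_vertex_comm a b)
  have h1 : normalSeries (w a) b + normalSeries (w b) a = 0 := by
    ext j
    simp only [normalSeries, map_add, PowerSeries.coeff_mk, hw, map_zero]
    rw [normalDeriv_smul hq ((hu j).comp_F hq a), normalDeriv_smul hq ((hu j).comp_F hq b),
      ← mul_add, (hu j).matching hq hab, mul_zero]
  refine ⟨h0, ?_⟩
  have e1 := h.dirichlet_to_neumann hq (ht a) b
  have e2 := h.dirichlet_to_neumann hq (ht b) a
  linear_combination -e1 - e2 + 2 * valSeries (p 0 2) 1 * h1
    - 2 * valSeries (p 0 1) 1 * h0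

theorem graphHarmonic_zero (hq : IsEquilateral q) (h : MonomialFamily q p) {i : ℕ}
    (hi : i ∈ Finset.Icc 1 3) : GraphHarmonic q (p 0 i 0) :=
  HasLaplacian.graphHarmonic hq ((h.mono 0 i hi).tower 0)

theorem harmonic_values (hq : IsEquilateral q) (h : MonomialFamily q p) {i : ℕ}
    (hi : i ∈ Finset.Icc 1 3) :
    2 * p 0 i 0 (vertex q 0) - p 0 i 0 (vertex q 1) - p 0 i 0 (vertex q 2)
      = (if i = 2 then 1 else 0) ∧
    p 0 i 0 (vertex q 1) - p 0 i 0 (vertex q 2) = (if i = 3 then 1 else 0) := by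
  have h1 := (h.mono 0 i hi).normal 0
  have h2 := (h.mono 0 i hi).tangential 0
  simp only [true_and] at h1 h2
  exact ⟨tendsto_nhds_unique ((h.graphHarmonic_zero hq hi).hasNormalDeriv hq 0) h1,
    tendsto_nhds_unique ((h.graphHarmonic_zero hq hi).hasTangentialDeriv hq 0) h2⟩

/-! ### Lowest coefficients and Dirichlet-to-Neumann identities of the monomials -/

theorem one_zero_vertex (hq : IsEquilateral q) (h : MonomialFamily q p) (i : Fin 3) :
    p 0 1 0 (vertex q i) = 1 := by
  have h0 := h.val_zero (i := 1) (by decide) 0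
  obtain ⟨h1, h2⟩ := h.harmonic_values hq (i := 1) (by decide)
  norm_num at h0 h1 h2
  match i with
  | 0 => exact h0
  | 1 => linarith
  | 2 => linarith

theorem one_zero (hq : IsEquilateral q) (h : MonomialFamily q p) : p 0 1 0 = 1 := by
  have h1 : HasLaplacian q (1 : C(gasket q, ℝ)) 0 := by
    intro ε hε
    refine ⟨0, fun m _ x _ => ?_⟩
    simpa [graphLaplacian] using hε
  have h2 := ((h.one 0).tower 0).sub hq h1
  rw [below, sub_self] at h2
  refine sub_eq_zero.1 (eq_zero_of_harmonic hq h2 fun i => ?_)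
  rw [ContinuousMap.sub_apply, h.one_zero_vertex hq]
  exact sub_self _

theorem normal_one_zero (hq : IsEquilateral q) (h : MonomialFamily q p) :
    normalDeriv q (p 0 1 0) 1 = 0 := by
  have := ((h.graphHarmonic_zero hq (i := 1) (by decide)).hasNormalDeriv hq 1).normalDeriv_eq
  rw [this]
  simp only [h.one_zero_vertex hq]
  norm_num

/-- Green's formula with the constant function 1: the total mass 1 equals the flux 2η_1 through q_1
and q_2. -/
theorem normal_one_one (hq : IsEquilateral q) (h : MonomialFamily q p) :
    normalDeriv q (p 0 1 1) 1 = 1 / 2 := by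
  have e := green hq ((h.one 0).tower 0) ((h.one 0).tower 1)
  have h1 : ip q (p 0 1 0) (p 0 1 0) = 1 := by
    rw [h.one_zero hq]
    simp [ip]
  simp only [below, ip_zero_left, h1, Fin.sum_univ_three, h.one_zero_vertex hq,
    h.normal_two hq (i := 1) (by decide), h.normal_one_zero hq,
    h.normal_zero (i := 1) (by decide)] at e
  norm_num at e
  linarith

theorem two_zero (hq : IsEquilateral q) (h : MonomialFamily q p) :
    p 0 2 0 (vertex q 1) = -(1 / 2) := by
  have h0 := h.val_zero (i := 2) (by decide) 0
  obtain ⟨h1, h2⟩ := h.harmonic_values hq (i := 2) (by decide)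
  norm_num at h0 h1 h2
  linarith

theorem three_zero (hq : IsEquilateral q) (h : MonomialFamily q p) :
    p 0 3 0 (vertex q 1) = 1 / 2 := by
  have h0 := h.val_zero (i := 3) (by decide) 0
  obtain ⟨h1, h2⟩ := h.harmonic_values hq (i := 3) (by decide)
  norm_num at h0 h1 h2
  linarith

theorem two_mul_beta_eta (hq : IsEquilateral q) (h : MonomialFamily q p) :
    2 * valSeries (p 0 2) 1 * normalSeries (p 0 1) 1
      = (1 - valSeries (p 0 1) 1) * (1 + 2 * valSeries (p 0 1) 1) := by
  have e := h.dirichlet_to_neumann hq (h.one 0).tower 1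
  rw [show (1 + 1 : Fin 3) = 2 by decide, sub_self, h.valSeries_two hq (by decide),
    h.valSeries_zero (by decide), if_pos rfl] at e
  linear_combination e

theorem two_mul_beta_kappa (hq : IsEquilateral q) (h : MonomialFamily q p) :
    2 * valSeries (p 0 2) 1 * normalSeries (p 0 3) 1
      = -(valSeries (p 0 3) 1 * (1 + 2 * valSeries (p 0 1) 1)) := by
  have e := h.dirichlet_to_neumann hq (h.three 0).tower 1
  rw [show (1 + 1 : Fin 3) = 2 by decide, sub_self, h.valSeries_three_two hq,
    h.valSeries_zero (by decide), if_neg (by decide)] at e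
  linear_combination e

theorem coeff_zero_alpha (hq : IsEquilateral q) (h : MonomialFamily q p) :
    PowerSeries.coeff 0 (valSeries (p 0 1) 1) = 1 := by
  rw [valSeries, PowerSeries.coeff_mk, h.one_zero_vertex hq]

/-- The coefficient of z in 2βη = (1 - α)(1 + 2α) reads 2β_0 η_1 = -3α_1, because η_0 = 0 and α_0 =
1. -/
theorem alpha_one (hq : IsEquilateral q) (h : MonomialFamily q p) :
    p 0 1 1 (vertex q 1) = 1 / 6 := by
  have e := congrArg (PowerSeries.coeff 1) (h.two_mul_beta_eta hq)
  have h2 : (2 : PowerSeries ℝ) = PowerSeries.C 2 := rfl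
  rw [h2, mul_assoc, PowerSeries.coeff_C_mul, PowerSeries.coeff_mul, PowerSeries.coeff_mul] at e
  simp only [Finset.Nat.sum_antidiagonal_succ, Finset.Nat.antidiagonal_zero, Finset.sum_singleton,
    map_sub, map_add, PowerSeries.coeff_C_mul, valSeries, normalSeries, PowerSeries.coeff_mk,
    h.one_zero_vertex hq, h.two_zero hq, zero_add, h.normal_one_one hq, h.normal_one_zero hq,
    PowerSeries.coeff_one] at e
  norm_num at e
  linarith

/-! ### Functional equations from one subdivision -/

theorem val_cell_self (u : ℕ → C(gasket q, ℝ)) (e : Fin 3) :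
    valSeries (fun j => (5 : ℝ) ^ j • (u j).comp (contF q e)) e
      = PowerSeries.rescale 5 (valSeries u e) := by
  ext j
  simp only [valSeries, PowerSeries.coeff_mk, PowerSeries.coeff_rescale, ContinuousMap.smul_apply,
    smul_eq_mul]
  congr 1
  exact congrArg (u j) (F_vertex_self e)

/-- Dilation invariance makes the rescaled tower on the cell at q_0 the tower itself, so its value
at F_0 q_1 is α. The two unknowns, α(5z) and the value c at F_1 q_2, are found from the equations at
these two midpoints. -/
theorem rescale_alpha (hq : IsEquilateral q) (h : MonomialFamily q p) :
    PowerSeries.rescale 5 (valSeries (p 0 1) 1)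
      = 4 * valSeries (p 0 1) 1 ^ 2 - 3 * valSeries (p 0 1) 1 := by
  set w : Fin 3 → ℕ → C(gasket q, ℝ) := fun e j => (5 : ℝ) ^ j • (p 0 1 j).comp (contF q e) with hw
  have hw' : ∀ e, w e = fun j => (5 : ℝ) ^ j • (p 0 1 j).comp (contF q e) := fun _ => rfl
  have hself := fun e => val_cell_self (p 0 1) e
  simp only [← hw'] at hself
  have hw0 : w 0 = p 0 1 := by
    have := ((h.one 0).comp_F hq (Or.inl ⟨rfl, rfl⟩)).unique hq (h.one 0)
    simpa only [one_smul] using this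
  obtain ⟨a1, a2⟩ := h.junction hq (h.one 0).tower (a := 0) (b := 1) (by decide) hw'
  obtain ⟨b1, b2⟩ := h.junction hq (h.one 0).tower (a := 1) (b := 2) (by decide) hw'
  obtain ⟨c1, -⟩ := h.junction hq (h.one 0).tower (a := 0) (b := 2) (by decide) hw'
  simp only [show (1 + 1 : Fin 3) = 2 by decide, show (0 + 1 : Fin 3) = 1 by decide,
    show (2 + 1 : Fin 3) = 0 by decide, show (1 - 1 : Fin 3) = 0 by decide,
    show (0 - 1 : Fin 3) = 2 by decide, show (2 - 1 : Fin 3) = 1 by decide] at a2 b2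
  rw [hself 1] at a2 b2
  rw [hself 2, ← c1, ← a1] at b2
  rw [hw0] at a2 b2
  simp only [h.valSeries_two hq (i := 1) (by decide), h.valSeries_zero (i := 1) (by decide),
    if_true] at a2 b2
  set α := valSeries (p 0 1) 1
  set c := valSeries (w 1) 2
  -- Eliminating α(5z) leaves 2(1 + 2α)c = 2(1 + 2α)(2α - 1); the common factor has constant
  -- coefficient 6 and cancels.
  have hne : 2 * (1 + 2 * α) ≠ 0 := fun h0 => by
    have := congrArg (PowerSeries.coeff 0) h0
    have h2 : (2 : PowerSeries ℝ) = PowerSeries.C 2 := rfl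
    rw [h2, PowerSeries.coeff_C_mul, map_add, PowerSeries.coeff_C_mul, h.coeff_zero_alpha hq] at this
    norm_num [PowerSeries.coeff_one] at this
  have hc : c = 2 * α - 1 := by
    refine mul_left_cancel₀ hne ?_
    linear_combination 2 * a2 - b2
  linear_combination a2 - hc

/-- Antisymmetry gives the value 0 at F_1 q_2, and dilation gives γ/5 at F_0 q_1, so the equation at
F_0 q_1 alone suffices. -/
theorem rescale_gamma (hq : IsEquilateral q) (h : MonomialFamily q p) :
    5 * PowerSeries.rescale 5 (valSeries (p 0 3) 1)
      = (4 * valSeries (p 0 1) 1 + 1) * valSeries (p 0 3) 1 := by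
  set w : Fin 3 → ℕ → C(gasket q, ℝ) := fun e j => (5 : ℝ) ^ j • (p 0 3 j).comp (contF q e) with hw
  have hw' : ∀ e, w e = fun j => (5 : ℝ) ^ j • (p 0 3 j).comp (contF q e) := fun _ => rfl
  have hself := val_cell_self (p 0 3) 1
  rw [← hw'] at hself
  have hw0 : ∀ i, 5 * valSeries (w 0) i = valSeries (p 0 3) i := by
    intro i
    have := ((h.three 0).comp_F hq (Or.inr ⟨rfl, rfl⟩)).unique hq (h.three 0)
    have h5 : (5 : PowerSeries ℝ) = PowerSeries.C 5 := rfl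
    ext j
    rw [h5, PowerSeries.coeff_C_mul]
    simp only [valSeries, PowerSeries.coeff_mk]
    conv_rhs => rw [← this]
    rfl
  obtain ⟨a1, a2⟩ := h.junction hq (h.three 0).tower (a := 0) (b := 1) (by decide) hw'
  simp only [show (1 + 1 : Fin 3) = 2 by decide, show (0 + 1 : Fin 3) = 1 by decide,
    show (1 - 1 : Fin 3) = 0 by decide, show (0 - 1 : Fin 3) = 2 by decide] at a2
  have hmid : valSeries (w 1) 2 = 0 := by
    ext j
    have hr := congrArg (fun f : C(gasket q, ℝ) => f (F q 1 (vertex q 2)))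
      (h.reflect_three_zero hq j)
    simp only [ContinuousMap.comp_apply, ContinuousMap.neg_apply, symmetry_F, symmetry_vertex,
      Equiv.swap_apply_left, Equiv.swap_apply_right, F_vertex_comm 2 1] at hr
    have h0 : p 0 3 j (F q 1 (vertex q 2)) = 0 := by linarith
    rw [valSeries, PowerSeries.coeff_mk, map_zero, hw', ContinuousMap.smul_apply, smul_eq_mul]
    exact mul_eq_zero_of_right _ h0
  rw [hself, hmid] at a2
  have e0 := hw0 0
  have e2 := hw0 2
  rw [h.valSeries_zero (by decide), if_neg (by decide)] at e0
  rw [h.valSeries_three_two hq] at e2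
  linear_combination 5 * a2 + 4 * valSeries (p 0 1) 1 * hw0 1 - e0 - e2

theorem alpha_sub_one (hq : IsEquilateral q) (h : MonomialFamily q p) :
    valSeries (p 0 1) 1 - 1
      = PowerSeries.X * PowerSeries.mk fun j => p 0 1 (j + 1) (vertex q 1) := by
  ext j
  cases j with
  | zero => simp [valSeries, h.one_zero_vertex hq]
  | succ j => simp [valSeries, PowerSeries.coeff_succ_X_mul, PowerSeries.coeff_one]

/-- In degree j ≥ 1 the equation expresses 5(5ʲ - 1) f_j through lower coefficients, so the constant
term determines f. -/
theorem eq_zero_of_rescale {a f : PowerSeries ℝ} (ha : PowerSeries.coeff 0 a = 5)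
    (hf : PowerSeries.coeff 0 f = 0) (h : 5 * PowerSeries.rescale 5 f = a * f) : f = 0 := by
  ext j
  rw [map_zero]
  induction j using Nat.strong_induction_on with
  | _ j ih =>
    obtain _ | j := j
    · exact hf
    have e := congrArg (PowerSeries.coeff (j + 1)) h
    have h5 : (5 : PowerSeries ℝ) = PowerSeries.C 5 := rfl
    rw [h5, PowerSeries.coeff_C_mul, PowerSeries.coeff_rescale, PowerSeries.coeff_mul,
      Finset.Nat.sum_antidiagonal_succ, ha, Finset.sum_eq_zero, add_zero] at e
    · have h1 : (1 : ℝ) < 5 ^ (j + 1) := one_lt_pow₀ (by norm_num) (by omega)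
      have h2 : (5 : ℝ) * (5 ^ (j + 1) - 1) ≠ 0 := by
        have : (0 : ℝ) < 5 ^ (j + 1) - 1 := by linarith
        positivity
      refine (mul_eq_zero.1 ?_).resolve_left h2
      linarith
    · rintro ⟨x, y⟩ hxy
      rw [Finset.HasAntidiagonal.mem_antidiagonal] at hxy
      simp only at hxy ⊢
      rw [ih y (by omega), mul_zero]

/-- Since α(5z) - 1 = (4α + 1)(α - 1), the series δ = (α - 1)/z satisfies the same equation as γ.
The constant terms are 1/2 for γ and 1/6 for δ, hence the factor 3. -/
theorem gamma_eq (hq : IsEquilateral q) (h : MonomialFamily q p) (j : ℕ) :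
    p 0 3 j (vertex q 1) = 3 * p 0 1 (j + 1) (vertex q 1) := by
  set δ : PowerSeries ℝ := PowerSeries.mk fun j => p 0 1 (j + 1) (vertex q 1) with hδ
  have h3 : (3 : PowerSeries ℝ) = PowerSeries.C 3 := rfl
  have hX := h.alpha_sub_one hq
  have hr : 5 * PowerSeries.rescale 5 δ = (4 * valSeries (p 0 1) 1 + 1) * δ := by
    refine mul_left_cancel₀ (PowerSeries.X_ne_zero (R := ℝ)) ?_
    have e := congrArg (PowerSeries.rescale (5 : ℝ)) hX
    have h5 : (5 : PowerSeries ℝ) = PowerSeries.C 5 := rfl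
    rw [map_sub, map_one, map_mul, h.rescale_alpha hq, PowerSeries.rescale_X, ← h5] at e
    linear_combination -e + (4 * valSeries (p 0 1) 1 + 1) * hX
  have h0 := eq_zero_of_rescale (a := 4 * valSeries (p 0 1) 1 + 1)
    (f := valSeries (p 0 3) 1 - 3 * δ) ?_ ?_ ?_
  · have := congrArg (PowerSeries.coeff j) h0
    rw [map_sub, h3, PowerSeries.coeff_C_mul, valSeries, PowerSeries.coeff_mk, hδ,
      PowerSeries.coeff_mk, map_zero] at this
    linarith
  · have h4 : (4 : PowerSeries ℝ) = PowerSeries.C 4 := rfl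
    rw [map_add, h4, PowerSeries.coeff_C_mul, h.coeff_zero_alpha hq, PowerSeries.coeff_one]
    norm_num
  · rw [map_sub, h3, PowerSeries.coeff_C_mul, valSeries, PowerSeries.coeff_mk, hδ,
      PowerSeries.coeff_mk, h.three_zero hq, zero_add, h.alpha_one hq]
    norm_num
  · rw [map_sub, map_mul, map_ofNat]
    linear_combination h.rescale_gamma hq - 3 * hr

/-- Inserting zγ = 3(α - 1) in the identity for 2βκ gives 2β · zκ = 2β · 3η, and β cancels because
β_0 = -1/2. -/
theorem kappa_eq (hq : IsEquilateral q) (h : MonomialFamily q p) (j : ℕ) :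
    normalDeriv q (p 0 3 j) 1 = 3 * normalDeriv q (p 0 1 (j + 1)) 1 := by
  have h3 : (3 : PowerSeries ℝ) = PowerSeries.C 3 := rfl
  have hβ : 2 * valSeries (p 0 2) 1 ≠ 0 := fun h0 => by
    have := congrArg (PowerSeries.coeff 0) h0
    have h2 : (2 : PowerSeries ℝ) = PowerSeries.C 2 := rfl
    rw [h2, PowerSeries.coeff_C_mul, valSeries, PowerSeries.coeff_mk, h.two_zero hq] at this
    norm_num at this
  have hg : PowerSeries.X * valSeries (p 0 3) 1 = 3 * (valSeries (p 0 1) 1 - 1) := by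
    rw [h.alpha_sub_one hq, mul_left_comm]
    congr 1
    ext j
    rw [h3, PowerSeries.coeff_C_mul, PowerSeries.coeff_mk, valSeries, PowerSeries.coeff_mk,
      h.gamma_eq hq]
  have hk : PowerSeries.X * normalSeries (p 0 3) 1 = 3 * normalSeries (p 0 1) 1 := by
    refine mul_left_cancel₀ hβ ?_
    linear_combination PowerSeries.X * h.two_mul_beta_kappa hq - 3 * h.two_mul_beta_eta hq
      - (1 + 2 * valSeries (p 0 1) 1) * hg
  have := congrArg (PowerSeries.coeff (j + 1)) hk
  rwa [PowerSeries.coeff_succ_X_mul, h3, PowerSeries.coeff_C_mul, normalSeries, normalSeries,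
    PowerSeries.coeff_mk, PowerSeries.coeff_mk] at this

/-- The constant 1 in 2τ = 1 - 2α affects only τ_0 = -1/2; this is the reason for α'_0 = 1/2. -/
theorem tau_eq (hq : IsEquilateral q) (h : MonomialFamily q p) (j : ℕ) :
    normalDeriv q (p 0 2 j) 1 = -(if j = 0 then 1 / 2 else p 0 1 j (vertex q 1)) := by
  have e := congrArg (PowerSeries.coeff j) (h.two_mul_normalSeries_two hq)
  have h2 : (2 : PowerSeries ℝ) = PowerSeries.C 2 := rfl
  rw [map_sub, h2, PowerSeries.coeff_C_mul, PowerSeries.coeff_C_mul, PowerSeries.coeff_one,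
    normalSeries, valSeries, PowerSeries.coeff_mk, PowerSeries.coeff_mk] at e
  split_ifs at e ⊢ with hj
  · subst hj
    rw [h.one_zero_vertex hq] at e
    linarith
  · linarith

/-! ### Inner products -/

theorem ip_rotate (hq : IsEquilateral q) (h : MonomialFamily q p) (n n' m : Fin 3) {i : ℕ}
    (hi : i ∈ Finset.Icc 1 3) (j k : ℕ) :
    ip q (p n i j) (p n' i k) = ip q (p (n - m) i j) (p (n' - m) i k) := by
  rw [← h.rotate hq n m hi, ← h.rotate hq n' m hi, ip_comp_symmetry]

theorem ip_three (hq : IsEquilateral q) (h : MonomialFamily q p) {i : ℕ}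
    (hi : i ∈ Finset.Icc 1 2) (j k : ℕ) : ip q (p 0 i j) (p 0 3 k) = 0 := by
  have := ip_comp_symmetry hq (Equiv.swap 1 2) (p 0 i j) (p 0 3 k)
  rw [h.reflect hq hi, h.reflect_three_zero hq, ip_neg_right] at this
  linarith

/-- The sum is again a tower, and at each vertex its three contributions are 0, γ_j and -γ_j. -/
theorem sum_three (hq : IsEquilateral q) (h : MonomialFamily q p) (j : ℕ) :
    p 0 3 j + p 1 3 j + p 2 3 j = 0 := by
  refine (((h.three 0).tower.add hq (h.three 1).tower).add hq (h.three 2).tower).eq_zero hq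
    (fun i j => ?_) j
  have hval : ∀ n m, p n 3 j (vertex q m) = p 0 3 j (vertex q (m - n)) := fun n m => by
    rw [← h.rotate hq n n (i := 3) (by decide) j, sub_self, ContinuousMap.comp_apply,
      symmetry_vertex]
    rfl
  have h0 := h.val_zero (i := 3) (by decide) j
  have h2 := h.val_three_two hq j
  simp only [OfNat.ofNat_ne_one, and_false, if_false] at h0
  rw [ContinuousMap.add_apply, ContinuousMap.add_apply, hval 1, hval 2]
  match i with
  | 0 =>
    rw [show (0 - 1 : Fin 3) = 2 by decide, show (0 - 2 : Fin 3) = 1 by decide]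
    linarith
  | 1 =>
    rw [show (1 - 1 : Fin 3) = 0 by decide, show (1 - 2 : Fin 3) = 2 by decide]
    linarith
  | 2 =>
    rw [show (2 - 1 : Fin 3) = 1 by decide, show (2 - 2 : Fin 3) = 0 by decide]
    linarith

/-- The reflection shows that the two mixed products are equal, and by `sum_three` they add up to
minus the unmixed one. -/
theorem ip_three_one (hq : IsEquilateral q) (h : MonomialFamily q p) (j k : ℕ) :
    ip q (p 0 3 j) (p 1 3 k) = -(1 / 2) * ip q (p 0 3 j) (p 0 3 k) ∧
    ip q (p 0 3 j) (p 2 3 k) = -(1 / 2) * ip q (p 0 3 j) (p 0 3 k) := by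
  have h1 := ip_comp_symmetry hq (Equiv.swap 1 2) (p 0 3 j) (p 1 3 k)
  rw [h.reflect_three_zero hq, h.reflect_three hq, ip_neg_right, ip_neg_left, neg_neg,
    Equiv.swap_apply_left] at h1
  have h2 := congrArg (ip q (p 0 3 j)) (h.sum_three hq k)
  rw [ip_add_right, ip_add_right, ip_zero_right] at h2
  constructor <;> linarith

theorem ip_three_ne (hq : IsEquilateral q) (h : MonomialFamily q p) {n n' : Fin 3} (hn : n ≠ n')
    (j k : ℕ) : ip q (p n 3 j) (p n' 3 k) = -(1 / 2) * ip q (p 0 3 j) (p 0 3 k) := by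
  rw [h.ip_rotate hq n n' n (by decide), sub_self]
  rcases (show ∀ n n' : Fin 3, n ≠ n' → n' - n = 1 ∨ n' - n = 2 by decide) n n' hn with e | e
  · rw [e]; exact (h.ip_three_one hq j k).1
  · rw [e]; exact (h.ip_three_one hq j k).2

end MonomialFamily

/-! ### Range of summation and the final formulas -/

theorem sum_Icc_of_symm {g f : ℕ → ℕ → ℝ} (hg : ∀ j k, g j k = g k j)
    (h : ∀ j k, g j k = ∑ l ∈ Finset.range (j + 1), f (j - l) (k + l + 1)) (j k : ℕ) :
    g j k = ∑ l ∈ Finset.Icc (j - min j k) j, f (j - l) (k + l + 1) := by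
  rcases le_total j k with hjk | hkj
  · rw [min_eq_left hjk, Nat.sub_self, h, ← Nat.range_succ_eq_Icc_zero]
  · rw [min_eq_right hkj, hg, h]
    -- After the exchange of j and k only k + 1 terms remain; the shift by j - k brings their
    -- arguments back to the form (j - l, k + l + 1).
    refine Finset.sum_bij (fun l _ => l + (j - k)) ?_ ?_ ?_ ?_
    · intro l hl
      rw [Finset.mem_range] at hl
      rw [Finset.mem_Icc]
      omega
    · intro a _ b _ hab
      omega
    · intro b hb
      rw [Finset.mem_Icc] at hb
      exact ⟨b - (j - k), by rw [Finset.mem_range]; omega, by omega⟩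
    · intro l hl
      rw [Finset.mem_range] at hl
      congr 1 <;> omega

end SierpinskiGasket

end

theorem lemma2p2 (q : Fin 3 → SierpinskiGasket.Plane) (hq : SierpinskiGasket.IsEquilateral q)
    (P : (n : Fin 3) → (j i : ℕ) → C(SierpinskiGasket.gasket q, ℝ))
    (hP : ∀ n j, ∀ i ∈ Finset.Icc 1 3, SierpinskiGasket.IsMonomial q n j i (P n j i))
    (α β α' : ℕ → ℝ)
    (hα : ∀ j, α j = P 0 j 1 (SierpinskiGasket.vertex q 1))
    (hβ : ∀ j, β j = P 0 j 2 (SierpinskiGasket.vertex q 1))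
    (hα' : ∀ j, α' j = if j = 0 then 1 / 2 else α j) :
    ∃ η : ℕ → ℝ, (∀ j, SierpinskiGasket.HasNormalDeriv q (P 0 j 1) 1 (η j)) ∧
      (∀ j k, SierpinskiGasket.ip q (P 0 j 1) (P 0 k 1)
        = 2 * ∑ l ∈ Finset.Icc (j - min j k) j,
            (α (j - l) * η (k + l + 1) - α (k + l + 1) * η (j - l))) ∧
      (∀ j k, SierpinskiGasket.ip q (P 0 j 2) (P 0 k 2)
        = -2 * ∑ l ∈ Finset.Icc (j - min j k) j,
            (β (j - l) * α' (k + l + 1) - β (k + l + 1) * α' (j - l))) ∧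
      (∀ j k, SierpinskiGasket.ip q (P 0 j 3) (P 0 k 3)
        = 18 * ∑ l ∈ Finset.Icc (j - min j k) j,
            (α (j - l + 1) * η (k + l + 2) - α (k + l + 2) * η (j - l + 1))) ∧
      (∀ j k, SierpinskiGasket.ip q (P 0 j 1) (P 0 k 2)
        = -2 * ∑ l ∈ Finset.Icc 0 j,
            (α (j - l) * α (k + l + 1) + β (k + l + 1) * η (j - l))) ∧
      (∀ j k, SierpinskiGasket.ip q (P 0 j 1) (P 0 k 3) = 0 ∧
        SierpinskiGasket.ip q (P 0 j 2) (P 0 k 3) = 0) ∧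
      (∀ n j k, SierpinskiGasket.ip q (P n j 3) (P n k 3)
        = SierpinskiGasket.ip q (P 0 j 3) (P 0 k 3)) ∧
      (∀ n n' j k, n ≠ n' → SierpinskiGasket.ip q (P n j 3) (P n' k 3)
        = -(1 / 2) * SierpinskiGasket.ip q (P 0 j 3) (P 0 k 3)) := by
  open SierpinskiGasket in
  have h : MonomialFamily q fun n i j => P n j i :=
    ⟨fun n i hi => isMonomialTower hq fun j => hP n j i hi⟩
  have hv0 := fun i hi j => h.val_zero (i := i) hi j
  have hn0 := fun i hi j => h.normal_zero (i := i) hi j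
  have hv2 := fun i hi j => h.val_two hq (i := i) hi j
  have hn2 := fun i hi j => h.normal_two hq (i := i) hi j
  have hv32 := h.val_three_two hq
  have hn32 := h.normal_three_two hq
  have hγ := h.gamma_eq hq
  have hκ := h.kappa_eq hq
  have hτ := h.tau_eq hq
  simp only [← hα] at hγ hτ
  simp only [← hα'] at hτ
  refine ⟨fun j => normalDeriv q (P 0 j 1) 1,
    fun j => ((h.one 0).tower j).hasNormalDeriv hq 1, fun j k => ?_, fun j k => ?_, fun j k => ?_,
    fun j k => ?_, fun j k => ⟨h.ip_three hq (by decide) j k, h.ip_three hq (by decide) j k⟩,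
    fun n j k => ?_, fun n n' j k hn => h.ip_three_ne hq hn j k⟩
  · rw [Finset.mul_sum]
    refine sum_Icc_of_symm (g := fun j k => ip q (P 0 j 1) (P 0 k 1))
      (f := fun a b => 2 * (α a * normalDeriv q (P 0 b 1) 1 - α b * normalDeriv q (P 0 a 1) 1))
      (fun j k => ip_comm _ _) (fun j k => ?_) j k
    rw [ip_tower hq (h.one 0).tower (h.one 0).tower j k]
    refine Finset.sum_congr rfl fun l _ => ?_
    rw [Fin.sum_univ_three]
    -- At q_0 both normal derivatives are zero, so only the two equal terms at q_1 and q_2 remain.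
    simp only [hv0 1 (by decide), hn0 1 (by decide), hv2 1 (by decide), hn2 1 (by decide), ← hα]
    simp
    ring
  · rw [Finset.mul_sum]
    refine sum_Icc_of_symm (g := fun j k => ip q (P 0 j 2) (P 0 k 2))
      (f := fun a b => -2 * (β a * α' b - β b * α' a))
      (fun j k => ip_comm _ _) (fun j k => ?_) j k
    rw [ip_tower hq (h.two 0).tower (h.two 0).tower j k]
    refine Finset.sum_congr rfl fun l _ => ?_
    rw [Fin.sum_univ_three]
    simp only [hv0 2 (by decide), hv2 2 (by decide), hn2 2 (by decide), ← hβ, hτ]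
    simp
    ring
  · rw [Finset.mul_sum]
    refine sum_Icc_of_symm (g := fun j k => ip q (P 0 j 3) (P 0 k 3))
      (f := fun a b => 18 * (α (a + 1) * normalDeriv q (P 0 (b + 1) 1) 1
        - α (b + 1) * normalDeriv q (P 0 (a + 1) 1) 1))
      (fun j k => ip_comm _ _) (fun j k => ?_) j k
    rw [ip_tower hq (h.three 0).tower (h.three 0).tower j k]
    refine Finset.sum_congr rfl fun l _ => ?_
    rw [Fin.sum_univ_three]
    -- Values and normal derivatives both change sign from q_1 to q_2, so the products agree; each
    -- factor contributes a 3, which gives 2·3·3.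
    simp only [hv0 3 (by decide), hv32, hn32, hγ, hκ]
    simp
    ring
  · rw [Finset.mul_sum, ← Nat.range_succ_eq_Icc_zero,
      ip_tower hq (h.one 0).tower (h.two 0).tower j k]
    refine Finset.sum_congr rfl fun l _ => ?_
    -- The index is positive, so the exceptional α'_0 never occurs; for the same reason the term at
    -- q_0 vanishes.
    have e : α' (k + l + 1) = α (k + l + 1) := by rw [hα', if_neg (Nat.succ_ne_zero _)]
    rw [Fin.sum_univ_three]
    simp only [hv0 1 (by decide), hv0 2 (by decide), hn0 1 (by decide), hn0 2 (by decide),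
      hv2 1 (by decide), hv2 2 (by decide), hn2 1 (by decide), hn2 2 (by decide), ← hα, ← hβ, hτ, e]
    simp
    ring
  · have := h.ip_rotate hq n n n (i := 3) (by decide) j k
    rwa [sub_self] at this
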